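/- For pairwise coprime integers $p,q,r\ge 3$ let $$Q_{\{p,q,r\}}(x)=\frac{(x^{pqr}-1)(x^p-1)(x^q-1)(x^r-1)}{(x^{pq}-1)(x^{qr}-1)(x^{rp}-1)(x-1)}=\sum_{0\le m\le (p-1)(q-1)(r-1)}a_m x^m$$ be the ternary inclusion–exclusion polynomial, which is a polynomial with integer coefficients of degree $(p-1)(q-1)(r-1)$. Put $\mathcal A_{p,q,r}=\{a_m\}$ (the set of its coefficients), $A^+(p,q,r)=\max_m a_m$, $A^-(p,q,r)=\min_m a_m$ and $A(p,q,r)=\max_m|a_m|$. Let $p\ge 3$ be an integer, let $t\in[1,p-1]$ be an integer coprime to $p$, let $s\in[1,p-1]$ be the inverse of $t$ modulo $p$, and put $\underline t=\min(t,p-t)$ and $\underline s=\min(s,p-s)$. Let $q,r,r'$ be integers with $r,r'>q>p^2$, $q\equiv t\pmod p$, $rt\equiv 1\pmod{pq}$ and $r't\equiv -1\pmod{pq}$. Then $$\mathcal A_{p,q,r'}=-\mathcal A_{p,q,r}:=\{-a: a\in\mathcal A_{p,q,r}\}.$$ Moreover: (i) If $t=s=1$, then $A^-(p,q,r)=-1$,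 $A^+(p,q,r)=1$ and $A(p,q,r)=1$. (ii) If $t>1$ and $\underline s<\underline t$, then $A^-(p,q,r)=-\underline s-1$, $A^+(p,q,r)=\underline s+1$ and $A(p,q,r)=\underline s+1$. (iii) If $t>1$, $\underline s\ge\underline t$ and $(\underline t,\underline s)=(t,s)$ or $(p-t,p-s)$, then $A^-(p,q,r)=-\underline s$, $A^+(p,q,r)=\underline s+1$ and $A(p,q,r)=\underline s+1$. (iv) If $t>1$, $\underline s\ge\underline t$ and $(\underline t,\underline s)=(t,p-s)$ or $(p-t,s)$, then $A^-(p,q,r)=-\underline s-1$, $A^+(p,q,r)=\underline s$ and $A(p,q,r)=\underline s+1$. -/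

import Mathlib

open Polynomial

namespace InclusionExclusion

/-- The numerator `(x^{pqr} - 1)(x^p - 1)(x^q - 1)(x^r - 1)`. -/
noncomputable def num (p q r : ℕ) : ℤ[X] :=
  (X ^ (p * q * r) - 1) * (X ^ p - 1) * (X ^ q - 1) * (X ^ r - 1)

/-- The denominator `(x^{pq} - 1)(x^{qr} - 1)(x^{rp} - 1)(x - 1)`. -/
noncomputable def den (p q r : ℕ) : ℤ[X] :=
  (X ^ (p * q) - 1) * (X ^ (q * r) - 1) * (X ^ (r * p) - 1) * (X - 1)

/-- The ternary inclusion-exclusion polynomial `Q_{p,q,r}`: the quotient of `num` by the monic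
polynomial `den`. The division is exact when `p, q, r` are positive and pairwise coprime,
see `Q_mul_den`. -/
noncomputable def Q (p q r : ℕ) : ℤ[X] := num p q r /ₘ den p q r

/-- `φ(p,q,r) = (p-1)(q-1)(r-1)`, the degree of `Q p q r`, see `natDegree_Q`. -/
def phi (p q r : ℕ) : ℕ := (p - 1) * (q - 1) * (r - 1)

/-- The coefficient set `𝒜_{p,q,r} = {a_m : 0 ≤ m ≤ φ(p,q,r)}`. -/
noncomputable def coeffSet (p q r : ℕ) : Finset ℤ :=
  (Finset.range (phi p q r + 1)).image (fun m => (Q p q r).coeff m)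

theorem coeffSet_nonempty (p q r : ℕ) : (coeffSet p q r).Nonempty :=
  Finset.Nonempty.image (Finset.nonempty_range_iff.mpr (Nat.succ_ne_zero _)) _

/-- `A⁺(p,q,r)`, the largest coefficient. -/
noncomputable def Aplus (p q r : ℕ) : ℤ := (coeffSet p q r).max' (coeffSet_nonempty p q r)

/-- `A⁻(p,q,r)`, the smallest coefficient. -/
noncomputable def Aminus (p q r : ℕ) : ℤ := (coeffSet p q r).min' (coeffSet_nonempty p q r)

/-- The height `A(p,q,r)`, the largest absolute value of a coefficient. -/
noncomputable def height (p q r : ℕ) : ℤ :=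
  (coeffSet p q r).sup' (coeffSet_nonempty p q r) (fun a => |a|)

theorem den_monic {p q r : ℕ} (hp : 0 < p) (hq : 0 < q) (hr : 0 < r) : (den p q r).Monic := by
  have h : ∀ n : ℕ, 0 < n → (X ^ n - 1 : ℤ[X]).Monic := fun n hn => by
    simpa using monic_X_pow_sub_C (1 : ℤ) hn.ne'
  have h1 : (X - 1 : ℤ[X]).Monic := by simpa using h 1 one_pos
  exact (((h _ (by positivity)).mul (h _ (by positivity))).mul (h _ (by positivity))).mul h1

theorem den_dvd_num {p q r : ℕ} (hp : 0 < p) (hq : 0 < q) (hr : 0 < r)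
    (hpq : p.Coprime q) (hqr : q.Coprime r) (hrp : r.Coprime p) : den p q r ∣ num p q r := by
  have hN : p * q * r ≠ 0 := by positivity
  have key : ∀ n : ℕ, n ∣ p * q * r → (X ^ n - 1 : ℤ[X]) =
      ∏ d ∈ (p * q * r).divisors, cyclotomic d ℤ ^ (if d ∣ n then 1 else 0) := by
    intro n hn
    have hn0 : 0 < n := Nat.pos_of_dvd_of_pos hn (Nat.pos_of_ne_zero hN)
    rw [← prod_cyclotomic_eq_X_pow_sub_one hn0 ℤ]
    have : n.divisors = (p * q * r).divisors.filter (fun d => d ∣ n) := by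
      ext d
      simp only [Nat.mem_divisors, Finset.mem_filter]
      exact ⟨fun h => ⟨⟨h.1.trans hn, hN⟩, h.1⟩, fun h => ⟨h.2, hn0.ne'⟩⟩
    rw [this, Finset.prod_filter]
    refine Finset.prod_congr rfl fun d _ => ?_
    split_ifs <;> simp
  have k1 := key 1 (one_dvd _)
  rw [pow_one] at k1
  unfold den num
  rw [k1, key (p * q * r) dvd_rfl, key p ⟨q * r, by ring⟩, key q ⟨p * r, by ring⟩,
    key r ⟨p * q, by ring⟩, key (p * q) ⟨r, by ring⟩, key (q * r) ⟨p, by ring⟩,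
    key (r * p) ⟨q, by ring⟩]
  simp only [← Finset.prod_mul_distrib, ← pow_add]
  refine Finset.prod_dvd_prod_of_dvd _ _ fun d hd => pow_dvd_pow _ ?_
  have h0 : d ∣ p * q * r := (Nat.mem_divisors.1 hd).1
  have common : ∀ a b c : ℕ, a.Coprime c → d ∣ a * b → d ∣ b * c → d ∣ b := by
    intro a b c hac h1 h2
    have := Nat.dvd_gcd h1 (by rwa [mul_comm] at h2 : d ∣ c * b)
    rwa [Nat.gcd_mul_right, hac.gcd_eq_one, one_mul] at this
  have c1 := common p q r hrp.symm
  have c2 := common q r p hpq.symm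
  have c3 := common r p q hqr.symm
  have o1 : d ∣ p → d ∣ q → d ∣ 1 := fun h1 h2 => hpq.gcd_eq_one ▸ Nat.dvd_gcd h1 h2
  have o2 : d ∣ q → d ∣ r → d ∣ 1 := fun h1 h2 => hqr.gcd_eq_one ▸ Nat.dvd_gcd h1 h2
  have o3 : d ∣ r → d ∣ p → d ∣ 1 := fun h1 h2 => hrp.gcd_eq_one ▸ Nat.dvd_gcd h1 h2
  have e1 : d ∣ 1 → d ∣ p ∧ d ∣ q ∧ d ∣ r := fun h =>
    ⟨h.trans (one_dvd _), h.trans (one_dvd _), h.trans (one_dvd _)⟩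
  have i1 : d ∣ p → d ∣ p * q ∧ d ∣ r * p := fun h => ⟨h.mul_right _, h.mul_left _⟩
  have i2 : d ∣ q → d ∣ p * q ∧ d ∣ q * r := fun h => ⟨h.mul_left _, h.mul_right _⟩
  have i3 : d ∣ r → d ∣ q * r ∧ d ∣ r * p := fun h => ⟨h.mul_left _, h.mul_right _⟩
  by_cases a1 : d ∣ p * q <;> by_cases a2 : d ∣ q * r <;> by_cases a3 : d ∣ r * p <;>
    by_cases b1 : d ∣ p <;> by_cases b2 : d ∣ q <;> by_cases b3 : d ∣ r <;>
    by_cases b0 : d ∣ 1 <;> simp only [h0, a1, a2, a3, b1, b2, b3, b0, if_true, if_false] <;>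
    omega

/-- `Q p q r` is the polynomial quotient of `num` by `den`. -/
theorem Q_mul_den {p q r : ℕ} (hp : 0 < p) (hq : 0 < q) (hr : 0 < r)
    (hpq : p.Coprime q) (hqr : q.Coprime r) (hrp : r.Coprime p) :
    Q p q r * den p q r = num p q r := by
  have h := modByMonic_add_div (num p q r) (den p q r)
  rw [(modByMonic_eq_zero_iff_dvd (den_monic hp hq hr)).2
    (den_dvd_num hp hq hr hpq hqr hrp), zero_add] at h
  rw [mul_comm]
  exact h

theorem natDegree_Q {p q r : ℕ} (hp : 0 < p) (hq : 0 < q) (hr : 0 < r) :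
    (Q p q r).natDegree = phi p q r := by
  have hm : ∀ n : ℕ, 0 < n → (X ^ n - 1 : ℤ[X]).Monic := fun n hn => by
    simpa using monic_X_pow_sub_C (1 : ℤ) hn.ne'
  have hd : ∀ n : ℕ, (X ^ n - 1 : ℤ[X]).natDegree = n := fun n => by
    simpa using natDegree_X_pow_sub_C (n := n) (r := (1 : ℤ))
  have m1 := hm 1 one_pos
  have d1 := hd 1
  rw [pow_one] at m1 d1
  have a := hm (p * q) (by positivity)
  have b := hm (q * r) (by positivity)
  have c := hm (r * p) (by positivity)
  have e := hm (p * q * r) (by positivity)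
  unfold Q
  rw [natDegree_divByMonic _ (den_monic hp hq hr)]
  unfold num den phi
  rw [((e.mul (hm p hp)).mul (hm q hq)).natDegree_mul (hm r hr),
    (e.mul (hm p hp)).natDegree_mul (hm q hq), e.natDegree_mul (hm p hp),
    ((a.mul b).mul c).natDegree_mul m1, (a.mul b).natDegree_mul c, a.natDegree_mul b, d1]
  simp only [hd]
  obtain ⟨x, rfl⟩ : ∃ x, p = x + 1 := ⟨p - 1, by omega⟩
  obtain ⟨y, rfl⟩ : ∃ y, q = y + 1 := ⟨q - 1, by omega⟩
  obtain ⟨z, rfl⟩ : ∃ z, r = z + 1 := ⟨r - 1, by omega⟩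
  simp only [Nat.add_sub_cancel]
  apply Nat.sub_eq_of_eq_add
  ring

end InclusionExclusion

/-! Write c_i for the coefficients of Q_{p,q} = (x^{pq}-1)(x-1)/((x^p-1)(x^q-1)). From
Q_{p,q,r}(x)(x^{pq}-1) = Q_{p,q}(x^r)(1+...+x^{p-1})(x^q-1), each a_n is a signed sum of the c_i
with i ≤ n/r, subject to congruences modulo pq (`coeff_Q`). As r ≥ p+q, the cutoff and the residue
of n may be varied independently (`mem_coeffSet_iff`). If rt ≡ ±1, the congruences place i on two
progressions w - tj and w - tq - tj, 0 ≤ j < p; a_n is the difference of the two truncated sums, and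
the sign of rt only changes its sign. This gives the first assertion.

Each c_i is a difference of two indicators of an arc of residues modulo p. Since st ≡ 1, both
arguments advance by one residue at each step along w - tj. Since q > p², the quotient i/q drops at
most once on the way, which makes one indicator repeat a residue. Passing to the complementary arc
if necessary, the arc has length k = min(s, p-s), and up to a global sign ε every window sum lies
between -k-1 and k.

The two progressions have the same total, and the cutoff splits at most one of them, so each
coefficient is plus or minus one window sum, with a restriction on e = w'/q (`cutSum_sub_eq`). The
value -k-1 forces k ≤ e ≤ p-1-k and t ≠ 1 (`of_mul_winSum_eq`). Hence εa = -k-1 requires k < t, and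
εa = k+1 requires k < p-t. Explicit windows show that these conditions, with t ≠ 1, suffice, and
that ±k always occur. The cases (i)-(iv) compare k with t and p-t. -/

namespace InclusionExclusion

/-! ### Indicators of arcs of residues -/

/-- The indicator function of the residues `0, …, k - 1` modulo `p`. -/
def arcInd (p k a : ℤ) : ℤ := if a % p < k then 1 else 0

/-- The indicator of a proposition, with integer values. -/
def indZ (P : Prop) [Decidable P] : ℤ := if P then 1 else 0

theorem indZ_congr {P R : Prop} [Decidable P] [Decidable R] (h : P ↔ R) : indZ P = indZ R := by
  unfold indZ
  simp only [h]

theorem arcInd_congr {p k a b : ℤ} (h : p ∣ a - b) : arcInd p k a = arcInd p k b := by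
  have : a % p = b % p := (Int.emod_emod_of_dvd a dvd_rfl).symm.trans
    (by rw [Int.emod_emod_of_dvd a dvd_rfl]; exact Int.emod_eq_emod_iff_emod_sub_eq_zero.2
          (Int.emod_eq_zero_of_dvd h))
  unfold arcInd
  rw [this]

theorem arcInd_of_mem {p k a : ℤ} (h0 : 0 ≤ a) (hp : a < p) :
    arcInd p k a = if a < k then 1 else 0 := by
  unfold arcInd
  rw [Int.emod_eq_of_lt h0 hp]

theorem arcInd_nonneg (p k a : ℤ) : 0 ≤ arcInd p k a := by
  unfold arcInd
  split_ifs <;> simp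

theorem arcInd_le_one (p k a : ℤ) : arcInd p k a ≤ 1 := by
  unfold arcInd
  split_ifs <;> simp

theorem dvd_iff_eq_zero_of_lt {p a : ℤ} (h1 : -p < a) (h2 : a < p) : p ∣ a ↔ a = 0 :=
  ⟨fun h => Int.eq_zero_of_abs_lt_dvd h (abs_lt.2 ⟨h1, h2⟩), fun h => h ▸ dvd_zero p⟩

/-- The indicator jumps up on entering the arc at residue 0 and down on leaving it at residue p - s.
-/
theorem arcInd_succ_sub {p s : ℤ} (hs : 0 < s) (hsp : s < p) (z : ℤ) :
    arcInd p (p - s) (z + 1) - arcInd p (p - s) z =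
      indZ (p ∣ z + 1) - indZ (p ∣ z + 1 + s) := by
  obtain ⟨k, ρ, hz, h0, h1⟩ : ∃ k ρ : ℤ, z = p * k + ρ ∧ 0 ≤ ρ ∧ ρ < p :=
    ⟨z / p, z % p, (Int.mul_ediv_add_emod z p).symm, Int.emod_nonneg _ (by omega),
      Int.emod_lt_of_pos _ (by omega)⟩
  have e1 : arcInd p (p - s) z = arcInd p (p - s) ρ := arcInd_congr ⟨k, by rw [hz]; ring⟩
  have d1 : p ∣ z + 1 ↔ p ∣ ρ + 1 - p := by
    rw [show z + 1 = p * (k + 1) + (ρ + 1 - p) by rw [hz]; ring, dvd_add_right (Dvd.intro _ rfl)]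
  have d2 : p ∣ z + 1 + s ↔ p ∣ ρ + 1 + s - p := by
    rw [show z + 1 + s = p * (k + 1) + (ρ + 1 + s - p) by rw [hz]; ring,
      dvd_add_right (Dvd.intro _ rfl)]
  rw [indZ_congr d1, indZ_congr d2, e1, arcInd_of_mem h0 h1,
    indZ_congr (dvd_iff_eq_zero_of_lt (p := p) (a := ρ + 1 - p) (by omega) (by omega))]
  have d3 : p ∣ ρ + 1 + s - p ↔ ρ + 1 + s - p = 0 := by
    by_cases h : ρ + 1 + s - p < p
    · exact dvd_iff_eq_zero_of_lt (by omega) h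
    · constructor
      · intro h'
        have := (dvd_iff_eq_zero_of_lt (p := p) (a := ρ + 1 + s - p - p) (by omega)
          (by omega)).1 (dvd_sub h' dvd_rfl)
        omega
      · omega
  rw [indZ_congr d3]
  unfold indZ
  by_cases h : ρ + 1 = p
  · rw [arcInd_congr (b := 0) ⟨k + 1, by rw [hz, ← h]; ring⟩, arcInd_of_mem le_rfl (by omega)]
    split_ifs <;> omega
  · rw [arcInd_congr (b := ρ + 1) ⟨k, by rw [hz]; ring⟩, arcInd_of_mem (by omega) (by omega)]
    split_ifs <;> omega

/-! ### Coefficients of the binary polynomial -/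

/-- For `s q ≡ 1 [MOD p]` and `0 ≤ i < p q`, the `i`-th coefficient of
`(x^{pq} - 1)(x - 1) / ((x^p - 1)(x^q - 1))`. -/
def binCoeff (p q s : ℕ) (i : ℤ) : ℤ :=
  arcInd p (p - s) (i / q - s * i) - arcInd p (p - s) (-(s * i) - 1)

/-- The `i`-th coefficient of `(1 - x) / (1 - x^p)`. -/
def geomCoeff (p : ℕ) (i : ℤ) : ℤ := indZ ((p : ℤ) ∣ i) - indZ ((p : ℤ) ∣ i - 1)

section binary

variable {p q s : ℕ}

theorem dvd_mul_inverse_iff (h : (p : ℤ) ∣ s * q - 1) (x : ℤ) : (p : ℤ) ∣ s * x ↔ (p : ℤ) ∣ x := by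
  refine ⟨fun hx => ?_, fun hx => hx.mul_left _⟩
  have : x = q * (s * x) - (s * q - 1) * x := by ring
  rw [this]
  exact dvd_sub (hx.mul_left _) (h.mul_right _)

/-- Replacing i by i + q raises both i/q and, modulo p, s*i by 1. The first arc term is unchanged
and the second moves back one residue, so only its jump remains. This is multiplication by 1 - x^q
read on coefficients. -/
theorem binCoeff_add_sub (hq : 0 < q) (hs : 0 < s) (hsp : s < p) (h : (p : ℤ) ∣ s * q - 1)
    (i : ℤ) : binCoeff p q s (i + q) - binCoeff p q s i = geomCoeff p (i + q) := by
  unfold binCoeff geomCoeff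
  have hdiv : (i + q) / (q : ℤ) = i / q + 1 := Int.add_ediv_of_dvd_right dvd_rfl |>.trans (by
    rw [Int.ediv_self (by exact_mod_cast hq.ne')])
  obtain ⟨k, hk⟩ := h
  rw [hdiv, arcInd_congr (a := i / q + 1 - s * (i + q)) (b := i / q - s * i)
      ⟨-k, by linear_combination -hk⟩,
    arcInd_congr (a := -(s * (i + q)) - 1) (b := -(s * i) - 2) ⟨-k, by linear_combination -hk⟩]
  have := arcInd_succ_sub (p := p) (s := s) (by exact_mod_cast hs) (by exact_mod_cast hsp)
    (-(s * i) - 2)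
  rw [show -((s : ℤ) * i) - 2 + 1 = -(s * i) - 1 by ring] at this
  rw [sub_sub_sub_cancel_left, this]
  congr 1
  · apply indZ_congr
    rw [← dvd_mul_inverse_iff ⟨k, hk⟩ (i + q), ← dvd_neg,
      show (s : ℤ) * (i + q) = -(-(s * i) - 1) + p * k by linear_combination hk]
    exact (dvd_add_left (Dvd.intro _ rfl)).symm
  · apply indZ_congr
    rw [← dvd_mul_inverse_iff ⟨k, hk⟩ (i + q - 1), ← dvd_neg,
      show (s : ℤ) * (i + q - 1) = -(-(s * i) - 1 + s) + p * k by linear_combination hk]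
    exact (dvd_add_left (Dvd.intro _ rfl)).symm

theorem binCoeff_of_lt (hs : 0 < s) (hsp : s < p) (h : (p : ℤ) ∣ s * q - 1)
    {i : ℤ} (h0 : 0 ≤ i) (hi : i < q) : binCoeff p q s i = geomCoeff p i := by
  unfold binCoeff geomCoeff
  have := arcInd_succ_sub (p := p) (s := s) (by exact_mod_cast hs) (by exact_mod_cast hsp)
    (-(s * i) - 1)
  rw [sub_add_cancel] at this
  rw [Int.ediv_eq_zero_of_lt h0 hi, zero_sub, this]
  congr 1
  · apply indZ_congr
    rw [dvd_neg, dvd_mul_inverse_iff h]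
  · apply indZ_congr
    rw [← dvd_mul_inverse_iff h (i - 1), ← dvd_neg,
      show -(-((s : ℤ) * i) + s) = s * (i - 1) by ring]

theorem binCoeff_of_neg {i : ℤ} (h0 : -q ≤ i) (hi : i < 0) : binCoeff p q s i = 0 := by
  unfold binCoeff
  have : i / (q : ℤ) = -1 := by
    rw [Int.ediv_eq_iff_of_pos (by omega)]
    constructor <;> omega
  rw [this, show -1 - (s : ℤ) * i = -(s * i) - 1 by ring, sub_self]

theorem binCoeff_add_period (hq : 0 < q) (i : ℤ) :
    binCoeff p q s (i + p * q) = binCoeff p q s i := by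
  unfold binCoeff
  rw [Int.add_mul_ediv_right _ _ (by exact_mod_cast hq.ne'),
    arcInd_congr (a := i / q + p - s * (i + p * q)) (b := i / q - s * i)
      ⟨1 - s * q, by ring⟩,
    arcInd_congr (a := -(s * (i + p * q)) - 1) (b := -(s * i) - 1) ⟨-(s * q), by ring⟩]

theorem binCoeff_of_ge (hq : 0 < q) {i : ℤ} (h0 : (p - 1) * q ≤ i) (hi : i < p * q) :
    binCoeff p q s i = 0 := by
  have := binCoeff_add_period (p := p) (s := s) hq (i - p * q)
  rw [sub_add_cancel] at this
  rw [this]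
  exact binCoeff_of_neg (by linarith) (by linarith)

theorem sum_geomCoeff_mul (hp : 2 ≤ p) (k : ℕ) :
    (∑ i ∈ Finset.range (p * k), C (geomCoeff p i) * X ^ i) * (X ^ p - 1) =
      (1 - X) * (X ^ (p * k) - 1 : ℤ[X]) := by
  induction k with
  | zero => simp
  | succ k ih =>
    have hb : ∑ l ∈ Finset.range p, C (geomCoeff p ((p * k + l : ℕ) : ℤ)) * X ^ (p * k + l) =
        X ^ (p * k) * (1 - X : ℤ[X]) := by
      have : ∀ l ∈ Finset.range p, C (geomCoeff p ((p * k + l : ℕ) : ℤ)) * X ^ (p * k + l) =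
          X ^ (p * k) * ((if l = 0 then 1 else 0) - (if l = 1 then X else 0) : ℤ[X]) := by
        intro l hl
        rw [Finset.mem_range] at hl
        have d1 : (p : ℤ) ∣ ((p * k + l : ℕ) : ℤ) ↔ l = 0 := by
          push_cast
          rw [dvd_add_right (Dvd.intro _ rfl), dvd_iff_eq_zero_of_lt (by omega) (by omega)]
          omega
        have d2 : (p : ℤ) ∣ ((p * k + l : ℕ) : ℤ) - 1 ↔ l = 1 := by
          push_cast
          rw [add_sub_assoc, dvd_add_right (Dvd.intro _ rfl),
            dvd_iff_eq_zero_of_lt (by omega) (by omega)]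
          omega
        unfold geomCoeff
        rw [indZ_congr d1, indZ_congr d2]
        unfold indZ
        by_cases h0 : l = 0
        · subst h0; simp
        · by_cases h1 : l = 1
          · subst h1; simp [pow_succ]
          · simp [h0, h1]
      rw [Finset.sum_congr rfl this, ← Finset.mul_sum, Finset.sum_sub_distrib,
        Finset.sum_ite_eq', Finset.sum_ite_eq', if_pos (by simp; omega), if_pos (by simp; omega)]
    rw [mul_add_one, Finset.sum_range_add, hb, add_mul, ih]
    ring

theorem sum_binCoeff_mul (hp : 2 ≤ p) (hq : 0 < q) (hs : 0 < s) (hsp : s < p)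
    (h : (p : ℤ) ∣ s * q - 1) :
    (∑ i ∈ Finset.range (p * q), C (binCoeff p q s i) * X ^ i) * ((X ^ p - 1) * (X ^ q - 1)) =
      (X ^ (p * q) - 1) * (X - 1 : ℤ[X]) := by
  obtain ⟨k, hk⟩ : ∃ k, p = k + 1 := ⟨p - 1, by omega⟩
  have e1 : p * q = q + k * q := by rw [hk]; ring
  have e2 : p * q = k * q + q := by rw [hk]; ring
  have h1 : ∑ i ∈ Finset.range (p * q), C (binCoeff p q s i) * X ^ i =
      ∑ i ∈ Finset.range (k * q), C (binCoeff p q s i) * (X : ℤ[X]) ^ i := by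
    -- The top q coefficients vanish, so multiplication by X^q creates no term of degree pq or more.
    rw [e2, Finset.sum_range_add, add_eq_left]
    refine Finset.sum_eq_zero fun l hl => ?_
    rw [Finset.mem_range] at hl
    rw [binCoeff_of_ge hq, C_0, zero_mul]
    · rw [hk]; push_cast; rw [add_sub_cancel_right]; omega
    · rw_mod_cast [e2]; omega
  have h2 : (∑ i ∈ Finset.range (p * q), C (binCoeff p q s i) * X ^ i) * (1 - X ^ q) =
      ∑ i ∈ Finset.range (p * q), C (geomCoeff p i) * (X : ℤ[X]) ^ i := by
    rw [mul_sub, mul_one]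
    nth_rw 2 [h1]
    rw [e1, Finset.sum_range_add, Finset.sum_range_add, Finset.sum_mul, add_sub_assoc,
      ← Finset.sum_sub_distrib]
    congr 1
    · refine Finset.sum_congr rfl fun i hi => ?_
      rw [Finset.mem_range] at hi
      rw [binCoeff_of_lt hs hsp h (by omega) (by omega)]
    · refine Finset.sum_congr rfl fun i _ => ?_
      have := binCoeff_add_sub hq hs hsp h i
      rw [show ((q + i : ℕ) : ℤ) = i + q by push_cast; ring, ← this, C_sub]
      ring
  calc _ = -((∑ i ∈ Finset.range (p * q), C (binCoeff p q s i) * X ^ i) * (1 - X ^ q) *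
        (X ^ p - 1)) := by ring
    _ = _ := by rw [h2, sum_geomCoeff_mul hp]; ring

end binary

/-! ### Ternary coefficients as truncated sums -/

section ternary

variable {p q r s : ℕ}

theorem Q_mul_X_pow_sub_one (hp : 2 ≤ p) (hq : 0 < q) (hr : 0 < r) (hs : 0 < s) (hsp : s < p)
    (h : (p : ℤ) ∣ s * q - 1) (hpq : p.Coprime q) (hqr : q.Coprime r) (hrp : r.Coprime p) :
    Q p q r * (X ^ (p * q) - 1) =
      (∑ i ∈ Finset.range (p * q), C (binCoeff p q s i) * X ^ (r * i)) *
        (∑ j ∈ Finset.range p, X ^ j) * (X ^ q - 1) := by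
  have hD := congrArg (expand ℤ r) (sum_binCoeff_mul hp hq hs hsp h)
  simp only [map_mul, map_sub, map_one, map_pow, expand_X, map_sum, expand_C, ← pow_mul] at hD
  have hQ := Q_mul_den (by omega) hq hr hpq hqr hrp
  unfold den num at hQ
  have hne : ∀ n : ℕ, 0 < n → (X ^ n - 1 : ℤ[X]) ≠ 0 := fun n hn => by
    simpa using (monic_X_pow_sub_C (1 : ℤ) hn.ne').ne_zero
  have hne1 : (X - 1 : ℤ[X]) ≠ 0 := by simpa using hne 1 one_pos
  apply mul_right_cancel₀ (mul_ne_zero (mul_ne_zero (hne (r * p) (by positivity))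
    (hne (r * q) (by positivity))) hne1)
  have hg := geom_sum_mul (X : ℤ[X]) p
  rw [mul_comm q r] at hQ
  calc _ = Q p q r * ((X ^ (p * q) - 1) * (X ^ (r * q) - 1) * (X ^ (r * p) - 1) * (X - 1)) := by
        ring
    _ = (X ^ (r * (p * q)) - 1) * (X ^ r - 1) * (X ^ p - 1) * (X ^ q - 1) := by
        rw [hQ, mul_comm r]; ring
    _ = _ := by rw [← hD, ← hg]; ring

/-- For `r` prime to `p q`, the value of this sum at `N = n / r` and `v = n` is the `n`-th
coefficient of `Q p q r`. -/
def truncSum (p q r s : ℕ) (N v : ℤ) : ℤ :=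
  ∑ i ∈ Finset.range (p * q), ∑ j ∈ Finset.range p,
    (if (i : ℤ) ≤ N then binCoeff p q s i else 0) *
      (indZ (((p * q : ℕ) : ℤ) ∣ v - r * i - j) - indZ (((p * q : ℕ) : ℤ) ∣ v - r * i - j - q))

theorem truncSum_of_neg {N : ℤ} (hN : N < 0) (v : ℤ) : truncSum p q r s N v = 0 :=
  Finset.sum_eq_zero fun i _ => Finset.sum_eq_zero fun j _ => by
    rw [if_neg (by omega), zero_mul]

/-- Telescoping form of (1 - x^M) · 1/(1 - x^M) = 1, applied to the term x^j. -/
theorem indZ_dvd_step {M m j : ℤ} (h0 : 0 ≤ j) (hj : j < M) :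
    (if 0 ≤ m then indZ (M ∣ m - j) else 0) - (if M ≤ m then indZ (M ∣ m - M - j) else 0) =
      indZ (m = j) := by
  have h : M ∣ m - M - j ↔ M ∣ m - j := by
    rw [show m - M - j = m - j - M by ring, dvd_sub_self_right]
  rw [indZ_congr h]
  by_cases h1 : M ≤ m
  · rw [if_pos (by omega), if_pos h1, sub_self]
    unfold indZ
    rw [if_neg (by omega)]
  · by_cases h2 : 0 ≤ m
    · rw [if_pos h2, if_neg h1, sub_zero,
        indZ_congr (dvd_iff_eq_zero_of_lt (by omega) (by omega))]
      exact indZ_congr (by omega)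
    · rw [if_neg h2, if_neg h1, sub_zero]
      unfold indZ
      rw [if_neg (by omega)]

theorem truncSum_sub (hr : 0 < r) (hpq : p < q) (hp : 2 ≤ p) (n : ℤ) :
    truncSum p q r s (n / r) n - truncSum p q r s ((n - (p * q : ℕ)) / r) (n - (p * q : ℕ)) =
      ∑ i ∈ Finset.range (p * q), ∑ j ∈ Finset.range p,
        binCoeff p q s i * (indZ (n = r * i + j) - indZ (n = r * i + j + q)) := by
  unfold truncSum
  rw [← Finset.sum_sub_distrib]
  refine Finset.sum_congr rfl fun i _ => ?_
  rw [← Finset.sum_sub_distrib]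
  refine Finset.sum_congr rfl fun j hj => ?_
  rw [Finset.mem_range] at hj
  have hM : ((p + q : ℕ) : ℤ) ≤ (p * q : ℕ) := by
    have : 2 * q ≤ p * q := Nat.mul_le_mul_right _ hp
    omega
  generalize ((p * q : ℕ) : ℤ) = M at *
  push_cast at hM
  have c1 : (i : ℤ) ≤ n / r ↔ 0 ≤ n - r * i := by
    rw [Int.le_ediv_iff_mul_le (by exact_mod_cast hr), sub_nonneg, mul_comm]
  have c2 : (i : ℤ) ≤ (n - M) / r ↔ M ≤ n - r * i := by
    rw [Int.le_ediv_iff_mul_le (by exact_mod_cast hr), mul_comm]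
    constructor <;> intro h <;> linarith
  have s1 := indZ_dvd_step (M := M) (m := n - r * i) (j := j) (by omega) (by omega)
  have s2 := indZ_dvd_step (M := M) (m := n - r * i) (j := j + q) (by omega) (by omega)
  rw [indZ_congr (show n = r * i + j ↔ n - r * i = j by constructor <;> intro h <;> linarith),
    indZ_congr (show n = r * i + j + q ↔ n - r * i = j + q by
      constructor <;> intro h <;> linarith), ← s1, ← s2]
  simp only [c1, c2, ← sub_sub]
  rw [show n - M - r * i = n - r * i - M by ring]
  split_ifs <;> ring

/-- Both sides satisfy the same recursion from n - pq to n, by `truncSum_sub` and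
`Q_mul_X_pow_sub_one`, and vanish for negative indices. -/
theorem coeff_Q (hp : 2 ≤ p) (hpq : p < q) (hr : 0 < r) (hs : 0 < s) (hsp : s < p)
    (h : (p : ℤ) ∣ s * q - 1) (cpq : p.Coprime q) (cqr : q.Coprime r) (crp : r.Coprime p)
    (n : ℕ) : (Q p q r).coeff n = truncSum p q r s ((n : ℤ) / r) n := by
  induction n using Nat.strong_induction_on with
  | _ n ih =>
  have hM : 0 < p * q := Nat.mul_pos (by omega) (by omega)
  have key := congrArg (fun f => coeff f n)
    (Q_mul_X_pow_sub_one hp (by omega) hr hs hsp h cpq cqr crp)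
  have hR : (∑ i ∈ Finset.range (p * q), C (binCoeff p q s i) * X ^ (r * i)) *
        (∑ j ∈ Finset.range p, X ^ j) * (X ^ q - 1) =
      ∑ i ∈ Finset.range (p * q), ∑ j ∈ Finset.range p,
        (C (binCoeff p q s i) * X ^ (r * i + j + q) -
          C (binCoeff p q s i) * (X : ℤ[X]) ^ (r * i + j)) := by
    rw [Finset.sum_mul_sum, Finset.sum_mul]
    refine Finset.sum_congr rfl fun i _ => ?_
    rw [Finset.sum_mul]
    refine Finset.sum_congr rfl fun j _ => ?_
    ring
  have hstep := truncSum_sub (s := s) hr hpq hp n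
  have hL : (Q p q r * (X ^ (p * q) - 1)).coeff n =
      (if p * q ≤ n then (Q p q r).coeff (n - p * q) else 0) - (Q p q r).coeff n := by
    rw [mul_sub, mul_one, coeff_sub, coeff_mul_X_pow']
  simp only [hR, hL, finsetSum_coeff, coeff_sub, coeff_C_mul, coeff_X_pow] at key
  have hS : ∑ i ∈ Finset.range (p * q), ∑ j ∈ Finset.range p,
      binCoeff p q s i * (indZ ((n : ℤ) = r * i + j) - indZ ((n : ℤ) = r * i + j + q)) =
      -∑ i ∈ Finset.range (p * q), ∑ j ∈ Finset.range p,
        ((binCoeff p q s i * if n = r * i + j + q then 1 else 0) -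
          binCoeff p q s i * if n = r * i + j then 1 else 0) := by
    rw [← Finset.sum_neg_distrib]
    refine Finset.sum_congr rfl fun i _ => ?_
    rw [← Finset.sum_neg_distrib]
    refine Finset.sum_congr rfl fun j _ => ?_
    rw [indZ_congr (show (n : ℤ) = r * i + j ↔ n = r * i + j by norm_cast),
      indZ_congr (show (n : ℤ) = r * i + j + q ↔ n = r * i + j + q by norm_cast)]
    unfold indZ
    ring
  rw [hS, ← key] at hstep
  by_cases hn : p * q ≤ n
  · rw [if_pos hn, ih (n - p * q) (by omega), Nat.cast_sub hn] at hstep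
    linarith
  · rw [if_neg hn, truncSum_of_neg (N := ((n : ℤ) - (p * q : ℕ)) / r)
      (Int.ediv_neg_of_neg_of_pos (by omega) (by exact_mod_cast hr))] at hstep
    linarith

theorem truncSum_congr {N v v' : ℤ} (hv : ((p * q : ℕ) : ℤ) ∣ v - v') :
    truncSum p q r s N v = truncSum p q r s N v' := by
  unfold truncSum
  refine Finset.sum_congr rfl fun i _ => Finset.sum_congr rfl fun j _ => ?_
  generalize ((p * q : ℕ) : ℤ) = M at *
  have e1 : M ∣ v - r * i - j ↔ M ∣ v' - r * i - j := by
    rw [show v - r * i - j = (v - v') + (v' - r * i - j) by ring, dvd_add_right hv]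
  have e2 : M ∣ v - r * i - j - q ↔ M ∣ v' - r * i - j - q := by
    rw [show v - r * i - j - q = (v - v') + (v' - r * i - j - q) by ring, dvd_add_right hv]
  rw [indZ_congr e1, indZ_congr e2]

/-- This decouples the cutoff N from the residue v. The zero alternative covers a negative
representative n. -/
theorem exists_coeff_eq_truncSum (hp : 2 ≤ p) (hpq : p < q) (hr : p + q ≤ r) (hs : 0 < s)
    (hsp : s < p) (h : (p : ℤ) ∣ s * q - 1) (cpq : p.Coprime q) (cqr : q.Coprime r)
    (crp : r.Coprime p) (N v : ℤ) :
    truncSum p q r s N v = 0 ∨ ∃ n : ℕ, (Q p q r).coeff n = truncSum p q r s N v := by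
  have hM : 0 < ((p * q : ℕ) : ℤ) := by
    have : 0 < p * q := Nat.mul_pos (by omega) (by omega)
    exact_mod_cast this
  obtain ⟨n, hnv, hn1, hn2⟩ : ∃ n : ℤ, ((p * q : ℕ) : ℤ) ∣ v - n ∧ n < (N + 1) * r ∧
      (N + 1) * r - (p * q : ℕ) ≤ n := by
    -- The largest n < (N + 1) r congruent to v modulo pq.
    refine ⟨(N + 1) * r - 1 - ((N + 1) * r - 1 - v) % (p * q : ℕ), ?_, ?_, ?_⟩
    · have := Int.dvd_sub_self_of_emod_eq
        (rfl : ((N + 1) * r - 1 - v) % (p * q : ℕ) = ((N + 1) * r - 1 - v) % (p * q : ℕ))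
      convert this using 1
      ring
    · have := Int.emod_nonneg ((N + 1) * r - 1 - v) hM.ne'
      linarith
    · have := Int.emod_lt_of_pos ((N + 1) * r - 1 - v) hM
      linarith
  have hr0 : (0 : ℤ) < r := by omega
  have hnN : n / r ≤ N := by
    have := Int.ediv_lt_of_lt_mul hr0 hn1
    omega
  have main : truncSum p q r s N v = truncSum p q r s (n / r) n := by
    rw [truncSum_congr hnv]
    unfold truncSum
    refine Finset.sum_congr rfl fun i _ => Finset.sum_congr rfl fun j hj => ?_
    rw [Finset.mem_range] at hj
    by_cases h1 : (i : ℤ) ≤ n / r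
    · rw [if_pos h1, if_pos (h1.trans hnN)]
    by_cases h2 : (i : ℤ) ≤ N
    · have h3 : n < i * r := by
        rw [← Int.ediv_lt_iff_lt_mul hr0]; omega
      have h4 : (i : ℤ) * r ≤ N * r := mul_le_mul_of_nonneg_right h2 hr0.le
      -- Indices with n/r < i ≤ N contribute nothing: n - ri - x lies strictly between -pq and 0 for
      -- 0 ≤ x < r, and both x = j and x = j + q are below p + q ≤ r.
      have aux : ∀ x : ℤ, 0 ≤ x → x < r → ¬ ((p * q : ℕ) : ℤ) ∣ n - r * i - x := by
        intro x hx0 hxr hd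
        have := (dvd_iff_eq_zero_of_lt (a := n - r * i - x + (p * q : ℕ)) (by linarith)
          (by linarith)).1 (dvd_add hd dvd_rfl)
        linarith
      have a1 := aux j (by omega) (by omega)
      have a2 := aux (j + q) (by omega) (by omega)
      rw [← sub_sub] at a2
      unfold indZ
      rw [if_neg a1, if_neg a2, sub_self, mul_zero, mul_zero]
    · rw [if_neg h1, if_neg h2]
  by_cases hn : 0 ≤ n
  · right
    lift n to ℕ using hn
    exact ⟨n, (coeff_Q hp hpq (by omega) hs hsp h cpq cqr crp n).trans main.symm⟩
  · left
    rw [main, truncSum_of_neg (Int.ediv_neg_of_neg_of_pos (by omega) hr0)]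

theorem mem_coeffSet_iff (hp : 3 ≤ p) (hpq : p < q) (hr : p + q ≤ r) (hs : 0 < s)
    (hsp : s < p) (h : (p : ℤ) ∣ s * q - 1) (cpq : p.Coprime q) (cqr : q.Coprime r)
    (crp : r.Coprime p) (a : ℤ) :
    a ∈ coeffSet p q r ↔ ∃ N v : ℤ, a = truncSum p q r s N v := by
  have hc := coeff_Q (by omega) hpq (by omega) hs hsp h cpq cqr crp
  -- The coefficient of x^p is 0; this accounts for vanishing truncated sums and for indices beyond
  -- the degree.
  have hzero : (0 : ℤ) ∈ coeffSet p q r := by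
    refine Finset.mem_image.2 ⟨p, Finset.mem_range.2 (Nat.lt_succ_of_le ?_), ?_⟩
    · unfold phi
      obtain ⟨x, rfl⟩ : ∃ x, p = x + 3 := ⟨p - 3, by omega⟩
      obtain ⟨y, rfl⟩ : ∃ y, q = y + 1 := ⟨q - 1, by omega⟩
      obtain ⟨z, rfl⟩ : ∃ z, r = z + 2 := ⟨r - 2, by omega⟩
      simp only [Nat.add_sub_cancel, show x + 3 - 1 = x + 2 by omega,
        show z + 2 - 1 = z + 1 by omega]
      nlinarith [Nat.zero_le ((x + 2) * y * z), Nat.zero_le (x * y), Nat.zero_le (x * z)]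
    · rw [hc, Int.ediv_eq_zero_of_lt (by omega) (by omega)]
      refine Finset.sum_eq_zero fun i _ => Finset.sum_eq_zero fun j hj => ?_
      rw [Finset.mem_range] at hj
      by_cases hi : i = 0
      · have hM : ((p + q : ℕ) : ℤ) ≤ (p * q : ℕ) := by
          have : 2 * q ≤ p * q := Nat.mul_le_mul_right _ (by omega)
          omega
        generalize ((p * q : ℕ) : ℤ) = M at *
        subst hi
        rw [indZ_congr (dvd_iff_eq_zero_of_lt (a := (p : ℤ) - r * (0 : ℕ) - j) (p := M)
            (by push_cast at *; omega) (by push_cast at *; omega)),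
          indZ_congr (dvd_iff_eq_zero_of_lt (a := (p : ℤ) - r * (0 : ℕ) - j - q) (p := M)
            (by push_cast at *; omega) (by push_cast at *; omega))]
        unfold indZ
        rw [if_neg (c := (p : ℤ) - r * (0 : ℕ) - j = 0) (by push_cast; omega),
          if_neg (c := (p : ℤ) - r * (0 : ℕ) - j - q = 0) (by push_cast; omega)]
        simp
      · rw [if_neg (by omega), zero_mul]
  constructor
  · intro ha
    obtain ⟨n, -, rfl⟩ := Finset.mem_image.1 ha
    exact ⟨_, _, hc n⟩
  · rintro ⟨N, v, rfl⟩
    have hmem : ∀ n : ℕ, (Q p q r).coeff n ∈ coeffSet p q r := by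
      intro n
      by_cases hn : n ≤ phi p q r
      · exact Finset.mem_image_of_mem _ (Finset.mem_range.2 (by omega))
      · rw [coeff_eq_zero_of_natDegree_lt]
        · exact hzero
        · rw [natDegree_Q (by omega) (by omega) (by omega)]
          omega
    rcases exists_coeff_eq_truncSum (by omega) hpq hr hs hsp h cpq cqr crp N v with h0 | ⟨n, hn⟩
    · rw [h0]; exact hzero
    · rw [← hn]; exact hmem n

end ternary

/-! ### Reindexing by the inverse of r -/

/-- The function of period `p q` that agrees with `binCoeff` on `[0, min N (p q - 1)]` and vanishes
on the rest of `[0, p q - 1]`. -/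
def cutCoeff (p q s : ℕ) (N z : ℤ) : ℤ :=
  if z % (p * q : ℕ) ≤ N then binCoeff p q s (z % (p * q : ℕ)) else 0

/-- The sum of `cutCoeff` over a progression with difference `-t`. -/
def cutSum (p q s t : ℕ) (N w : ℤ) : ℤ := ∑ j ∈ Finset.range p, cutCoeff p q s N (w - t * j)

section reindex

variable {p q r s t : ℕ}

theorem cutCoeff_congr {N z z' : ℤ} (h : ((p * q : ℕ) : ℤ) ∣ z - z') :
    cutCoeff p q s N z = cutCoeff p q s N z' := by
  unfold cutCoeff
  rw [Int.emod_eq_emod_iff_emod_sub_eq_zero.2 (Int.emod_eq_zero_of_dvd h)]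

theorem cutSum_congr {N w w' : ℤ} (h : ((p * q : ℕ) : ℤ) ∣ w - w') :
    cutSum p q s t N w = cutSum p q s t N w' :=
  Finset.sum_congr rfl fun j _ => cutCoeff_congr (by
    rwa [sub_sub_sub_cancel_right])

theorem sum_mul_indZ_dvd {M : ℕ} (hM : 0 < M) (f : ℤ → ℤ) (u : ℤ) :
    ∑ i ∈ Finset.range M, f i * indZ ((M : ℤ) ∣ u - i) = f (u % M) := by
  have hM' : (0 : ℤ) < M := by exact_mod_cast hM
  obtain ⟨k, hk⟩ : ∃ k : ℕ, (k : ℤ) = u % M :=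
    ⟨(u % M).toNat, Int.toNat_of_nonneg (Int.emod_nonneg _ hM'.ne')⟩
  have hkM : (k : ℤ) < M := hk ▸ Int.emod_lt_of_pos _ hM'
  rw [Finset.sum_eq_single_of_mem k (Finset.mem_range.2 (by exact_mod_cast hkM))]
  · unfold indZ
    rw [if_pos, mul_one, hk]
    rw [hk]
    exact Int.dvd_self_sub_emod
  · intro i hi hik
    rw [Finset.mem_range] at hi
    unfold indZ
    rw [if_neg, mul_zero]
    intro hd
    have : (M : ℤ) ∣ (u - i) - (u - k) := dvd_sub hd (by rw [hk]; exact Int.dvd_self_sub_emod)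
    rw [sub_sub_sub_cancel_left, dvd_iff_eq_zero_of_lt (by omega) (by omega)] at this
    omega

/-- Since τt inverts r modulo pq, each divisibility condition selects the single index i ≡ τt(v -
j), or τt(v - j - q). -/
theorem truncSum_eq_sum_cutCoeff (hM : 0 < p * q) {τ : ℤ} (hτ : τ * τ = 1)
    (h : ((p * q : ℕ) : ℤ) ∣ r * t - τ) (N v : ℤ) :
    truncSum p q r s N v = ∑ j ∈ Finset.range p,
      (cutCoeff p q s N (τ * t * (v - j)) - cutCoeff p q s N (τ * t * (v - j - q))) := by
  unfold truncSum
  rw [Finset.sum_comm]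
  refine Finset.sum_congr rfl fun j _ => ?_
  have key : ∀ u : ℤ, ∀ i : ℕ, ((p * q : ℕ) : ℤ) ∣ u - r * i ↔
      ((p * q : ℕ) : ℤ) ∣ τ * t * u - i := by
    intro u i
    constructor
    · intro hd
      have : τ * t * u - i = τ * t * (u - r * i) + τ * i * (r * t - τ) := by
        linear_combination i * hτ
      rw [this]
      exact dvd_add (hd.mul_left _) (h.mul_left _)
    · intro hd
      have : u - r * i = r * (τ * t * u - i) - τ * u * (r * t - τ) := by
        linear_combination -u * hτ
      rw [this]
      exact dvd_sub (hd.mul_left _) (h.mul_left _)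
  have e := fun u : ℤ =>
    sum_mul_indZ_dvd hM (fun i => if i ≤ N then binCoeff p q s i else 0) (τ * t * u)
  unfold cutCoeff
  rw [← e, ← e, ← Finset.sum_sub_distrib]
  refine Finset.sum_congr rfl fun i _ => ?_
  rw [mul_sub, ← indZ_congr (key (v - j) i), ← indZ_congr (key (v - j - q) i)]
  rw [show v - j - (r : ℤ) * i = v - r * i - j by ring,
    show v - j - q - (r : ℤ) * i = v - r * i - j - q by ring]

theorem truncSum_eq_of_mul_eq_one (hM : 0 < p * q) (h : ((p * q : ℕ) : ℤ) ∣ r * t - 1)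
    (N v : ℤ) : truncSum p q r s N v =
      cutSum p q s t N (t * v) - cutSum p q s t N (t * v - t * q) := by
  rw [truncSum_eq_sum_cutCoeff hM (mul_one 1) h]
  unfold cutSum
  rw [← Finset.sum_sub_distrib]
  refine Finset.sum_congr rfl fun j _ => ?_
  congr 2 <;> ring

/-- Here the progression has difference +t; the reflection j ↦ p - 1 - j restores -t, and the shift
by tq exchanges the two progressions, hence the sign. -/
theorem truncSum_eq_of_mul_eq_neg_one (hM : 0 < p * q) (h : ((p * q : ℕ) : ℤ) ∣ r * t - -1)
    (N v : ℤ) : truncSum p q r s N v =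
      -(cutSum p q s t N (-t * v + t * (p - 1) + t * q) -
        cutSum p q s t N (-t * v + t * (p - 1))) := by
  rw [truncSum_eq_sum_cutCoeff hM (by norm_num) h, ← Finset.sum_range_reflect]
  unfold cutSum
  rw [← Finset.sum_sub_distrib, ← Finset.sum_neg_distrib]
  refine Finset.sum_congr rfl fun j hj => ?_
  rw [Finset.mem_range] at hj
  have : ((p - 1 - j : ℕ) : ℤ) = p - 1 - j := by omega
  rw [this, neg_sub]
  congr 2 <;> ring

theorem mem_coeffSet_iff_of_mul_eq_one (hp : 3 ≤ p) (hpq : p < q) (hr : p + q ≤ r) (hs : 0 < s)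
    (hsp : s < p) (h : (p : ℤ) ∣ s * q - 1) (cpq : p.Coprime q) (cqr : q.Coprime r)
    (crp : r.Coprime p) (hrt : ((p * q : ℕ) : ℤ) ∣ r * t - 1) (a : ℤ) :
    a ∈ coeffSet p q r ↔
      ∃ N w : ℤ, a = cutSum p q s t N w - cutSum p q s t N (w - t * q) := by
  have hM : 0 < p * q := Nat.mul_pos (by omega) (by omega)
  rw [mem_coeffSet_iff hp hpq hr hs hsp h cpq cqr crp]
  constructor
  · rintro ⟨N, v, rfl⟩
    exact ⟨N, t * v, truncSum_eq_of_mul_eq_one hM hrt N v⟩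
  · rintro ⟨N, w, rfl⟩
    refine ⟨N, r * w, ?_⟩
    have hd : ((p * q : ℕ) : ℤ) ∣ w - t * (r * w) := by
      rw [show w - t * (r * w) = -w * (r * t - 1) by ring]
      exact hrt.mul_left _
    rw [truncSum_eq_of_mul_eq_one hM hrt, cutSum_congr hd,
      cutSum_congr (w := w - t * q) (w' := t * (r * w) - t * q) (by
        rwa [sub_sub_sub_cancel_right])]

theorem mem_coeffSet_iff_of_mul_eq_neg_one (hp : 3 ≤ p) (hpq : p < q) (hr : p + q ≤ r)
    (hs : 0 < s) (hsp : s < p) (h : (p : ℤ) ∣ s * q - 1) (cpq : p.Coprime q) (cqr : q.Coprime r)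
    (crp : r.Coprime p) (hrt : ((p * q : ℕ) : ℤ) ∣ r * t - -1) (a : ℤ) :
    a ∈ coeffSet p q r ↔
      ∃ N w : ℤ, a = -(cutSum p q s t N w - cutSum p q s t N (w - t * q)) := by
  have hM : 0 < p * q := Nat.mul_pos (by omega) (by omega)
  rw [mem_coeffSet_iff hp hpq hr hs hsp h cpq cqr crp]
  constructor
  · rintro ⟨N, v, rfl⟩
    refine ⟨N, -t * v + t * (p - 1) + t * q, ?_⟩
    rw [truncSum_eq_of_mul_eq_neg_one hM hrt, add_sub_cancel_right]
  · rintro ⟨N, w, rfl⟩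
    refine ⟨N, r * (w - t * (p - 1) - t * q), ?_⟩
    have hd : ((p * q : ℕ) : ℤ) ∣
        w - (-t * (r * (w - t * (p - 1) - t * q)) + t * (p - 1) + t * q) := by
      rw [show w - (-t * (r * (w - t * (p - 1) - t * q)) + t * (p - 1) + t * q) =
        (w - t * (p - 1) - t * q) * (r * t - -1) by ring]
      exact hrt.mul_left _
    rw [truncSum_eq_of_mul_eq_neg_one hM hrt, cutSum_congr hd,
      cutSum_congr (w := w - t * q)
        (w' := -t * (r * (w - t * (p - 1) - t * q)) + t * (p - 1)) (by
        convert hd using 1; ring)]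

end reindex

/-! ### Sums of arc indicators over windows -/

/-- The sum of the coefficients `binCoeff` over the part `x ≤ j < y` of the progression
`w - t j`. -/
def winSum (p q s t : ℕ) (w : ℤ) (x y : ℕ) : ℤ :=
  ∑ j ∈ Finset.Ico x y, binCoeff p q s (w - t * j)

theorem sum_arcInd {p : ℕ} {σ : ℤ} (h0 : 0 ≤ σ) (h1 : σ ≤ p) (a : ℤ) :
    ∑ j ∈ Finset.range p, arcInd p σ (a + j) = σ := by
  have hper : ∀ a : ℤ, ∑ j ∈ Finset.range p, arcInd p σ (a + 1 + j) =
      ∑ j ∈ Finset.range p, arcInd p σ (a + j) := by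
    intro a
    have e1 := Finset.sum_range_succ (fun j : ℕ => arcInd p σ (a + j)) p
    have e2 := Finset.sum_range_succ' (fun j : ℕ => arcInd p σ (a + j)) p
    have e3 : arcInd p σ (a + p) = arcInd p σ (a + (0 : ℕ)) :=
      arcInd_congr ⟨1, by push_cast; ring⟩
    have e4 : ∑ j ∈ Finset.range p, arcInd p σ (a + 1 + j) =
        ∑ j ∈ Finset.range p, arcInd p σ (a + (j + 1 : ℕ)) :=
      Finset.sum_congr rfl fun j _ => by push_cast; ring_nf
    linarith
  have hbase : ∑ j ∈ Finset.range p, arcInd p σ (0 + j) = σ := by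
    obtain ⟨k, rfl⟩ := Int.eq_ofNat_of_zero_le h0
    have : ∀ j ∈ Finset.range p, arcInd p k (0 + j) = if j < k then 1 else 0 := by
      intro j hj
      rw [Finset.mem_range] at hj
      rw [zero_add, arcInd_of_mem (by omega) (by omega)]
      norm_cast
    rw [Finset.sum_congr rfl this, Finset.sum_boole]
    have : {j ∈ Finset.range p | j < k} = Finset.range k := by
      ext j
      simp only [Finset.mem_filter, Finset.mem_range]
      omega
    rw [this, Finset.card_range]
  induction a using Int.induction_on with
  | zero => exact hbase
  | succ n ih => rw [hper, ih]
  | pred n ih =>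
    have := hper (-n - 1)
    rw [sub_add_cancel] at this
    rw [← this, ih]

theorem sum_Ico_arcInd_le {p : ℕ} {σ : ℤ} (h0 : 0 ≤ σ) (h1 : σ ≤ p) (a : ℤ) {x y : ℕ}
    (hxy : y ≤ x + p) : ∑ j ∈ Finset.Ico x y, arcInd p σ (a + j) ≤ σ := by
  calc _ ≤ ∑ j ∈ Finset.Ico x (x + p), arcInd p σ (a + j) :=
        Finset.sum_le_sum_of_subset_of_nonneg (Finset.Ico_subset_Ico_right hxy)
          fun _ _ _ => arcInd_nonneg _ _ _
    _ = σ := by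
        rw [Finset.sum_Ico_eq_sum_range, Nat.add_sub_cancel_left]
        refine Eq.trans (Finset.sum_congr rfl fun j _ => ?_) (sum_arcInd h0 h1 (a + x))
        push_cast
        rw [add_assoc]

section arc

variable {p : ℕ} {σ : ℤ}

theorem sum_delayed_le (h0 : 0 ≤ σ) (h1 : σ ≤ p) (a : ℤ) {x y J : ℕ}
    (hxy : y ≤ x + p) (hJ : J ≤ x ∨ y ≤ J) :
    ∑ j ∈ Finset.Ico x y, arcInd p σ (a + j - if J ≤ j then 1 else 0) ≤ σ := by
  rcases hJ with hJ | hJ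
  · calc _ = ∑ j ∈ Finset.Ico x y, arcInd p σ (a - 1 + j) :=
          Finset.sum_congr rfl fun j hj => by
            rw [Finset.mem_Ico] at hj
            rw [if_pos (by omega)]
            ring_nf
      _ ≤ σ := sum_Ico_arcInd_le h0 h1 _ hxy
  · calc _ = ∑ j ∈ Finset.Ico x y, arcInd p σ (a + j) :=
          Finset.sum_congr rfl fun j hj => by
            rw [Finset.mem_Ico] at hj
            rw [if_neg (by omega), sub_zero]
      _ ≤ σ := sum_Ico_arcInd_le h0 h1 _ hxy

/-- Deleting the repeated residue leaves a run of consecutive residues that is shorter by one. -/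
theorem sum_delayed_eq (a : ℤ) {x y J : ℕ} (hx : x < J) (hy : J < y) :
    ∑ j ∈ Finset.Ico x y, arcInd p σ (a + j - if J ≤ j then 1 else 0) =
      ∑ j ∈ Finset.Ico x (y - 1), arcInd p σ (a + j) + arcInd p σ (a + J - 1) := by
  obtain ⟨y, rfl⟩ : ∃ z, y = z + 1 := ⟨y - 1, by omega⟩
  rw [Nat.add_sub_cancel, ← Finset.sum_Ico_consecutive _ hx.le hy.le,
    ← Finset.sum_Ico_consecutive _ hx.le (by omega : J ≤ y), add_assoc]
  congr 1
  · refine Finset.sum_congr rfl fun j hj => ?_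
    rw [Finset.mem_Ico] at hj
    rw [if_neg (by omega), sub_zero]
  · rw [Finset.sum_eq_sum_Ico_succ_bot hy, if_pos le_rfl, ← Finset.sum_Ico_add' _ J y 1, add_comm]
    congr 1
    refine Finset.sum_congr rfl fun j hj => ?_
    rw [Finset.mem_Ico] at hj
    rw [if_pos (by omega)]
    push_cast
    ring_nf

/-- A difference of two indicators of an arc of length `σ`, along two progressions of
residues modulo `p`, the second of which repeats one residue, at `j = J`. -/
def arcDiff (p : ℕ) (σ a e : ℤ) (J j : ℕ) : ℤ :=
  arcInd p σ (a + j - e - 1) - arcInd p σ (a + j - if J ≤ j then 1 else 0)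

theorem sum_shift_nonneg (a e : ℤ) (x y : ℕ) :
    0 ≤ ∑ j ∈ Finset.Ico x y, arcInd p σ (a + j - e - 1) :=
  Finset.sum_nonneg fun _ _ => arcInd_nonneg _ _ _

theorem sum_arcDiff_le (h0 : 0 ≤ σ) (h1 : σ ≤ p) (a e : ℤ) (J : ℕ) {x y : ℕ}
    (hxy : y ≤ x + p) : ∑ j ∈ Finset.Ico x y, arcDiff p σ a e J j ≤ σ := by
  unfold arcDiff
  rw [Finset.sum_sub_distrib]
  have hA : ∑ j ∈ Finset.Ico x y, arcInd p σ (a + j - e - 1) ≤ σ := by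
    refine le_trans (le_of_eq ?_) (sum_Ico_arcInd_le h0 h1 (a - e - 1) hxy)
    exact Finset.sum_congr rfl fun j _ => by ring_nf
  have hB : 0 ≤ ∑ j ∈ Finset.Ico x y, arcInd p σ (a + j - if J ≤ j then 1 else 0) :=
    Finset.sum_nonneg fun _ _ => arcInd_nonneg _ _ _
  linarith

theorem le_sum_arcDiff (h0 : 0 ≤ σ) (h1 : σ ≤ p) (a e : ℤ) (J : ℕ) {x y : ℕ}
    (hxy : y ≤ x + p) : -σ - 1 ≤ ∑ j ∈ Finset.Ico x y, arcDiff p σ a e J j := by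
  unfold arcDiff
  rw [Finset.sum_sub_distrib]
  have hA := sum_shift_nonneg (p := p) (σ := σ) a e x y
  by_cases hJ : J ≤ x ∨ y ≤ J
  · have := sum_delayed_le h0 h1 a hxy hJ
    linarith
  · push Not at hJ
    rw [sum_delayed_eq a hJ.1 hJ.2]
    have h2 := sum_Ico_arcInd_le h0 h1 a (x := x) (y := y - 1) (by omega)
    have h3 := arcInd_le_one p σ (a + J - 1)
    linarith

/-- Equality case of `le_sum_arcDiff`: the delayed indicator must see the whole arc plus a repeated
residue in it, while the shifted one never meets its arc in the window. That is possible only if the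
shift e + 1 moves the arc clear of the window. -/
theorem of_sum_arcDiff_le (h0 : 0 < σ) (h1 : σ ≤ p) {a e : ℤ} {J x y : ℕ}
    (hy : y ≤ p) (he : 0 ≤ e) (hep : e < p)
    (h : ∑ j ∈ Finset.Ico x y, arcDiff p σ a e J j ≤ -σ - 1) :
    σ ≤ e ∧ e ≤ p - 1 - σ ∧ arcInd p σ (a + J - 1) = 1 := by
  unfold arcDiff at h
  rw [Finset.sum_sub_distrib] at h
  have hA := sum_shift_nonneg (p := p) (σ := σ) a e x y
  by_cases hJ : J ≤ x ∨ y ≤ J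
  · have := sum_delayed_le h0.le h1 a (by omega) hJ
    linarith
  push Not at hJ
  rw [sum_delayed_eq a hJ.1 hJ.2] at h
  have h2 := sum_Ico_arcInd_le h0.le h1 a (x := x) (y := y - 1) (by omega)
  have h3 := arcInd_le_one p σ (a + J - 1)
  have e1 : ∑ j ∈ Finset.Ico x (y - 1), arcInd p σ (a + j) = σ := by linarith
  have e2 : ∑ j ∈ Finset.Ico x y, arcInd p σ (a + j - e - 1) = 0 := by linarith
  rw [Finset.sum_eq_zero_iff_of_nonneg fun _ _ => arcInd_nonneg _ _ _] at e2
  have hp : 0 < p := by omega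
  have out : ∀ j < p, j ∉ Finset.Ico x (y - 1) → arcInd p σ (a + j) = 0 := by
    have hsub : Finset.Ico x (y - 1) ⊆ Finset.range p := fun j hj => by
      rw [Finset.mem_Ico] at hj
      rw [Finset.mem_range]
      omega
    have e3 := Finset.sum_sdiff (f := fun j : ℕ => arcInd p σ (a + j)) hsub
    rw [sum_arcInd h0.le h1, e1, add_eq_right,
      Finset.sum_eq_zero_iff_of_nonneg fun _ _ => arcInd_nonneg _ _ _] at e3
    intro j hj hj'
    exact e3 j (Finset.mem_sdiff.2 ⟨Finset.mem_range.2 hj, hj'⟩)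
  have hp' : (0 : ℤ) < p := by exact_mod_cast hp
  -- The arc starts at position i, where a + i ≡ 0; by `out`, it occupies i, ..., i + σ - 1 inside
  -- [x, y - 1).
  obtain ⟨i, hi, hip⟩ : ∃ i : ℕ, (p : ℤ) ∣ a + i ∧ i < p := by
    refine ⟨((-a) % p).toNat, ?_, ?_⟩
    · rw [Int.toNat_of_nonneg (Int.emod_nonneg _ hp'.ne')]
      have : (p : ℤ) ∣ -a - (-a) % p := Int.dvd_self_sub_emod
      rwa [show -a - (-a) % p = -(a + (-a) % p) by ring, dvd_neg] at this
    · have := Int.emod_lt_of_pos (-a) hp'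
      have := Int.emod_nonneg (-a) hp'.ne'
      omega
  have val : ∀ z d : ℤ, z = a + i + d → 0 ≤ d → d < σ → arcInd p σ z = 1 := by
    intro z d hz hd0 hd1
    rw [arcInd_congr (b := d) (by rw [hz, add_sub_cancel_right]; exact hi),
      arcInd_of_mem hd0 (by omega), if_pos hd1]
  have m1 : i ∈ Finset.Ico x (y - 1) := by
    by_contra hcon
    have := out i hip hcon
    rw [val _ 0 (by ring) le_rfl h0] at this
    exact one_ne_zero this
  rw [Finset.mem_Ico] at m1
  have m2 : (i : ℤ) + σ ≤ y - 1 := by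
    by_contra hcon
    have := out (y - 1) (by omega) (by simp)
    rw [val _ ((y - 1 : ℕ) - i) (by ring) (by omega) (by omega)] at this
    exact one_ne_zero this
  have hz : ∀ j : ℤ, x ≤ j → j < y → ¬ (0 ≤ j - e - 1 - i ∧ j - e - 1 - i < σ) := by
    rintro j hj1 hj2 ⟨hj3, hj4⟩
    lift j to ℕ using (by omega)
    have := e2 j (Finset.mem_Ico.2 ⟨by exact_mod_cast hj1, by exact_mod_cast hj2⟩)
    rw [val _ _ (by ring) hj3 hj4] at this
    exact one_ne_zero this
  -- If e < σ, the shifted arc starts in the window, at i + e + 1. If e > p - 1 - σ, its last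
  -- residue, taken one period earlier, is in the window at i + e + σ - p. Both contradict `e2`.
  refine ⟨?_, ?_, by linarith⟩
  · by_contra hcon
    exact hz (i + e + 1) (by omega) (by omega) ⟨by omega, by omega⟩
  · by_contra hcon
    have hj1 : (x : ℤ) ≤ i + e + σ - p := by omega
    lift i + e + σ - p to ℕ using (by omega) with j hj
    have := e2 j (Finset.mem_Ico.2 ⟨by omega, by omega⟩)
    rw [arcInd_congr (b := a + i + (σ - 1)) ⟨-1, by rw [hj]; ring⟩,
      val _ (σ - 1) rfl (by omega) (by omega)] at this
    exact one_ne_zero this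

/-- With e = k and a ≡ k + 1, the shifted indicator has argument j ≥ k and vanishes, while the
delayed one sees the k residues of the arc and repeats one of them. -/
theorem sum_arcDiff_eq_of_break {k : ℕ} (h0 : 0 < k) (h1 : 2 * k < p) {a : ℤ} {J : ℕ}
    (ha : (p : ℤ) ∣ a - (k + 1)) (hJ : p ≤ J + k) (hJp : J < p) :
    ∑ j ∈ Finset.Ico k p, arcDiff p k a k J j ≤ -k - 1 := by
  unfold arcDiff
  rw [Finset.sum_sub_distrib, sum_delayed_eq a (by omega) hJp]
  obtain ⟨c, hc⟩ := ha
  have e1 : ∑ j ∈ Finset.Ico k p, arcInd p k (a + j - k - 1) = 0 := by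
    refine Finset.sum_eq_zero fun j hj => ?_
    rw [Finset.mem_Ico] at hj
    rw [arcInd_congr (b := j) ⟨c, by linear_combination hc⟩, arcInd_of_mem (by omega) (by omega),
      if_neg (by omega)]
  have e2 : arcInd p k (a + J - 1) = 1 := by
    rw [arcInd_congr (b := k + J - p) ⟨c + 1, by linear_combination hc⟩,
      arcInd_of_mem (by omega) (by omega), if_pos (by omega)]
  have e3 : (k : ℤ) ≤ ∑ j ∈ Finset.Ico k (p - 1), arcInd p k (a + j) := by
    calc (k : ℤ) = ∑ j ∈ Finset.Ico (p - 1 - k) (p - 1), 1 := by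
          rw [Finset.sum_const, Nat.card_Ico, nsmul_eq_mul, mul_one]
          omega
      _ = ∑ j ∈ Finset.Ico (p - 1 - k) (p - 1), arcInd p k (a + j) :=
          Finset.sum_congr rfl fun j hj => by
            rw [Finset.mem_Ico] at hj
            rw [arcInd_congr (b := k + 1 + j - p) ⟨c + 1, by linear_combination hc⟩,
              arcInd_of_mem (by omega) (by omega), if_pos (by omega)]
      _ ≤ _ := Finset.sum_le_sum_of_subset_of_nonneg
          (Finset.Ico_subset_Ico_left (by omega)) fun _ _ _ => arcInd_nonneg _ _ _
  linarith

theorem sum_arcDiff_eq_of_no_break {k : ℕ} (h1 : 2 * k < p) {a : ℤ} {J : ℕ}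
    (ha : (p : ℤ) ∣ a - k) (hJ : p ≤ J) :
    ∑ j ∈ Finset.Ico (p - k) p, arcDiff p k a (k - 1) J j = -k := by
  unfold arcDiff
  obtain ⟨c, hc⟩ := ha
  have : ∀ j ∈ Finset.Ico (p - k) p, arcInd p k (a + j - ((k : ℤ) - 1) - 1) -
      arcInd p k (a + j - if J ≤ j then 1 else 0) = -1 := by
    intro j hj
    rw [Finset.mem_Ico] at hj
    rw [if_neg (by omega), arcInd_congr (b := j) ⟨c, by linear_combination hc⟩,
      arcInd_of_mem (by omega) (by omega), if_neg (by omega),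
      arcInd_congr (b := k + j - p) ⟨c + 1, by linear_combination hc⟩,
      arcInd_of_mem (by omega) (by omega), if_pos (by omega)]
    norm_num
  rw [Finset.sum_congr rfl this, Finset.sum_const, Nat.card_Ico, nsmul_eq_mul]
  have : ((p - (p - k) : ℕ) : ℤ) = k := by omega
  rw [this]
  ring

theorem sum_arcDiff_range_eq_zero (h0 : 0 ≤ σ) (h1 : σ ≤ p) (a e : ℤ) {J : ℕ} (hJ : p ≤ J) :
    ∑ j ∈ Finset.Ico 0 p, arcDiff p σ a e J j = 0 := by
  unfold arcDiff
  rw [Finset.sum_sub_distrib, ← Finset.range_eq_Ico, sub_eq_zero]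
  trans σ
  · exact Eq.trans (Finset.sum_congr rfl fun j _ => by ring_nf) (sum_arcInd h0 h1 (a - e - 1))
  · refine (Eq.trans (Finset.sum_congr rfl fun j hj => ?_) (sum_arcInd h0 h1 a)).symm
    rw [Finset.mem_range] at hj
    rw [if_neg (by omega), sub_zero]

end arc

/-! ### Truncated progressions when q > p² -/

/-- The hypotheses on `p`, `q`, `t` and the inverse `s` of `t` modulo `p`. -/
structure Admissible (p q s t : ℕ) : Prop where
  three_le : 3 ≤ p
  s_pos : 0 < s
  s_lt : s < p
  t_pos : 0 < t
  t_lt : t < p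
  dvd_st : (p : ℤ) ∣ s * t - 1
  dvd_qt : (p : ℤ) ∣ q - t
  sq_lt : p ^ 2 < q

namespace Admissible

variable {p q s t : ℕ} (h : Admissible p q s t)
include h

theorem dvd_sq : (p : ℤ) ∣ s * q - 1 := by
  rw [show (s : ℤ) * q - 1 = s * (q - t) + (s * t - 1) by ring]
  exact dvd_add (h.dvd_qt.mul_left _) h.dvd_st

theorem lt_q : p < q := by
  have := h.three_le
  have := h.sq_lt
  nlinarith

/-- The bound q > p² enters here: a progression w - tj with j < p spans less than q, so it crosses
at most one multiple of q. -/
theorem mul_lt {j : ℕ} (hj : j ≤ p) : (t : ℤ) * j + 1 < q := by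
  have h1 := h.t_lt
  have h2 := h.three_le
  have h3 := h.sq_lt
  have : t * j ≤ t * p := Nat.mul_le_mul_left _ hj
  have : (t + 1) * p ≤ p * p := Nat.mul_le_mul_right _ h1
  have : t * j + 1 < q := by nlinarith
  exact_mod_cast this

/-- No wrap-around correction is needed, because `binCoeff` vanishes both on [-q, 0) and on [(p-1)q,
pq). -/
theorem cutCoeff_of_mem (N : ℤ) {z : ℤ} (h0 : -q ≤ z) (h1 : z < (p * q : ℕ)) :
    cutCoeff p q s N z = if z ≤ N then binCoeff p q s z else 0 := by
  have hq : 0 < q := by have := h.lt_q; omega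
  unfold cutCoeff
  by_cases hz : 0 ≤ z
  · rw [Int.emod_eq_of_lt hz h1]
  · have hp := h.three_le
    have hM : q ≤ p * q := Nat.le_mul_of_pos_left _ (by omega)
    have e : z % (p * q : ℕ) = z + (p * q : ℕ) := by
      rw [← Int.add_emod_right, Int.emod_eq_of_lt (by omega) (by omega)]
    rw [e, binCoeff_of_neg h0 (by omega), binCoeff_of_ge hq, ite_self, ite_self]
    · push_cast; linarith
    · push_cast; linarith

theorem cutSum_eq_winSum {N w : ℤ} (h0 : 0 ≤ w) (h1 : w < (p * q : ℕ)) {κ : ℕ}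
    (hκ : ∀ j < p, w - t * j ≤ N ↔ κ ≤ j) : cutSum p q s t N w = winSum p q s t w κ p := by
  unfold cutSum winSum
  have : ∀ j ∈ Finset.range p, cutCoeff p q s N (w - t * j) =
      if κ ≤ j then binCoeff p q s (w - t * j) else 0 := by
    intro j hj
    rw [Finset.mem_range] at hj
    have := h.mul_lt hj.le
    have h2 : (0 : ℤ) ≤ t * j := by positivity
    rw [h.cutCoeff_of_mem N (by omega) (by omega)]
    simp only [hκ j hj]
  rw [Finset.sum_congr rfl this, ← Finset.sum_filter]
  congr 1
  ext j
  simp only [Finset.mem_filter, Finset.mem_range, Finset.mem_Ico]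
  omega

theorem cutSum_eq_zero {N w : ℤ} (h0 : 0 ≤ w) (h1 : w < (p * q : ℕ)) (hN : N + q ≤ w + 1) :
    cutSum p q s t N w = 0 := by
  rw [h.cutSum_eq_winSum h0 h1 (κ := p)]
  · simp [winSum]
  · intro j hj
    have := h.mul_lt hj.le
    omega

theorem cutSum_eq_total {N w : ℤ} (h0 : 0 ≤ w) (h1 : w < (p * q : ℕ)) (hN : w ≤ N) :
    cutSum p q s t N w = winSum p q s t w 0 p := by
  refine h.cutSum_eq_winSum h0 h1 fun j hj => ?_
  have h2 : (0 : ℤ) ≤ t * j := by positivity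
  omega

theorem exists_threshold (N w : ℤ) (n : ℕ) :
    ∃ κ ≤ n, ∀ j < n, w - t * j ≤ N ↔ κ ≤ j := by
  have ht : (0 : ℤ) < t := by exact_mod_cast h.t_pos
  induction n with
  | zero => exact ⟨0, le_rfl, fun j hj => by omega⟩
  | succ n ih =>
    obtain ⟨κ, hκ, hj⟩ := ih
    by_cases hn : w - t * n ≤ N
    · refine ⟨κ, by omega, fun j hj' => ?_⟩
      rcases Nat.lt_succ_iff_lt_or_eq.1 hj' with h1 | rfl
      · exact hj j h1
      · exact ⟨fun _ => hκ, fun _ => hn⟩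
    · refine ⟨n + 1, le_rfl, fun j hj' => ?_⟩
      have : (t : ℤ) * j ≤ t * n := mul_le_mul_of_nonneg_left (by omega) ht.le
      constructor <;> intro <;> omega

theorem winSum_period (w : ℤ) (x y : ℕ) :
    winSum p q s t (w + (p * q : ℕ)) x y = winSum p q s t w x y := by
  unfold winSum
  refine Finset.sum_congr rfl fun j _ => ?_
  have hq : 0 < q := by have := h.lt_q; omega
  rw [← binCoeff_add_period (i := w - t * j) hq]
  congr 1
  push_cast
  ring

theorem winSum_total (w : ℤ) :
    winSum p q s t w 0 p = ∑ j ∈ Finset.range p,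
      arcInd p (p - s) ((w - t * j) / q - s * w + j) - (p - s) := by
  obtain ⟨c, hc⟩ := h.dvd_st
  have hs := h.s_lt
  have hs0 := h.s_pos
  unfold winSum binCoeff
  rw [← Finset.range_eq_Ico, Finset.sum_sub_distrib]
  congr 1
  · refine Finset.sum_congr rfl fun j _ => arcInd_congr ⟨c * j, ?_⟩
    linear_combination (j : ℤ) * hc
  · refine Eq.trans (Finset.sum_congr rfl fun j _ => arcInd_congr ⟨c * j, ?_⟩)
      (sum_arcInd (p := p) (σ := p - s) (by omega) (by omega) (-(s * w) - 1))
    linear_combination (j : ℤ) * hc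

/-- Subtracting tq lowers the quotient by t and, as sq ≡ 1, lowers s*w by t modulo p; the two
changes cancel. -/
theorem winSum_total_sub (w : ℤ) :
    winSum p q s t (w - t * q) 0 p = winSum p q s t w 0 p := by
  obtain ⟨c, hc⟩ := h.dvd_sq
  have hq : (q : ℤ) ≠ 0 := by have := h.lt_q; omega
  rw [h.winSum_total, h.winSum_total]
  congr 1
  refine Finset.sum_congr rfl fun j _ => arcInd_congr ⟨c * t, ?_⟩
  have : (w - t * q - t * j) / (q : ℤ) = (w - t * j) / q - t := by
    rw [show w - t * q - t * j = (w - t * j) + (-t) * q by ring, Int.add_mul_ediv_right _ _ hq]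
    ring
  rw [this]
  linear_combination t * hc

theorem le_ediv_iff (k w : ℤ) : k ≤ w / q ↔ k * q ≤ w :=
  Int.le_ediv_iff_mul_le (by have := h.lt_q; omega)

/-- The starting points, reduced to [0, pq), are far enough apart that the cutoff splits at most one
progression. Either the lower one is split and the upper one contributes nothing, or the lower one
is complete; equal totals then turn a suffix of the upper one into a prefix. -/
theorem cutSum_sub_eq (N : ℤ) {w : ℤ} (h0 : 0 ≤ w) (h1 : w < (p * q : ℕ)) :
    ∃ (w' : ℤ) (x y : ℕ), 0 ≤ w' ∧ w' < (p * q : ℕ) ∧ y ≤ p ∧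
      ((cutSum p q s t N w - cutSum p q s t N (w - t * q) = winSum p q s t w' x y ∧
          (w' / q < t ∨ p - t ≤ w' / q)) ∨
        (cutSum p q s t N w - cutSum p q s t N (w - t * q) = -winSum p q s t w' x y ∧
          (w' / q < p - t ∨ t ≤ w' / q))) := by
  have hq := h.lt_q
  have ht := h.t_lt
  have ht0 := h.t_pos
  have hpre : ∀ (w : ℤ) (κ : ℕ), κ ≤ p → winSum p q s t w κ p =
      winSum p q s t w 0 p - winSum p q s t w 0 κ := fun w κ hκ => by
    unfold winSum
    rw [← Finset.sum_Ico_consecutive _ (Nat.zero_le κ) hκ, add_sub_cancel_left]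
  obtain ⟨κ, hκ, hκ'⟩ := h.exists_threshold N w p
  have htot := h.winSum_total_sub w
  have htq : (q : ℤ) ≤ t * q := le_mul_of_one_le_left (by omega) (by omega)
  have htq' : (t + 1 : ℤ) * q ≤ p * q := mul_le_mul_of_nonneg_right (by omega) (by omega)
  have hcast : ((p * q : ℕ) : ℤ) = p * q := by push_cast; ring
  by_cases he : t ≤ w / q
  · have hw := (h.le_ediv_iff _ _).1 he
    rcases hκ.lt_or_eq with hlt | rfl
    · refine ⟨w, 0, κ, h0, h1, hκ, Or.inr ⟨?_, Or.inr he⟩⟩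
      have h2 := (hκ' (p - 1) (by omega)).2 (by omega)
      have h3 := h.mul_lt (Nat.sub_le p 1)
      rw [h.cutSum_eq_winSum h0 h1 hκ', h.cutSum_eq_total (by omega) (by omega) (by omega),
        hpre w κ hκ, htot]
      ring
    · obtain ⟨κ', hκp, hκ2⟩ := h.exists_threshold N (w - t * q) κ
      refine ⟨w - t * q, κ', κ, by omega, by omega, le_rfl, Or.inr ⟨?_, Or.inl ?_⟩⟩
      · rw [h.cutSum_eq_winSum h0 h1 hκ', h.cutSum_eq_winSum (by omega) (by omega) hκ2]
        simp [winSum]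
      · by_contra hcon
        rw [not_lt, h.le_ediv_iff] at hcon
        have : ((κ : ℤ) - t) * q = κ * q - t * q := by ring
        omega
  · have hw := mt (h.le_ediv_iff _ _).2 he
    have hcut : cutSum p q s t N (w - t * q) = cutSum p q s t N (w - t * q + (p * q : ℕ)) :=
      cutSum_congr (by rw [sub_add_cancel_left, dvd_neg])
    rw [← h.winSum_period] at htot
    rw [hcut]
    generalize hw' : w - t * q + (p * q : ℕ) = w' at *
    have hlin : (t + 1 : ℤ) * q = t * q + q := by ring
    obtain ⟨κ', hκp, hκ2⟩ := h.exists_threshold N w' p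
    rcases hκp.lt_or_eq with hlt | hpe
    · refine ⟨w', 0, κ', by omega, by omega, hκp, Or.inl ⟨?_, Or.inr ?_⟩⟩
      · have h2 := (hκ2 (p - 1) (by omega)).2 (by omega)
        have h3 := h.mul_lt (Nat.sub_le p 1)
        rw [h.cutSum_eq_winSum (by omega) (by omega) hκ2, h.cutSum_eq_total h0 h1 (by omega),
          hpre w' κ' hκp, htot]
        ring
      · rw [h.le_ediv_iff]
        have : ((p : ℤ) - t) * q = p * q - t * q := by ring
        omega
    · refine ⟨w, κ, p, h0, h1, le_rfl, Or.inl ⟨?_, Or.inl (by omega)⟩⟩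
      rw [hpe] at hκ2
      rw [h.cutSum_eq_winSum h0 h1 hκ', h.cutSum_eq_winSum (by omega) (by omega) hκ2]
      simp [winSum]

theorem cutSum_at_term {w : ℤ} (h0 : 0 ≤ w) (h1 : w < (p * q : ℕ)) (κ : ℕ) :
    cutSum p q s t (w - t * κ) w = winSum p q s t w κ p := by
  have ht : (0 : ℤ) < t := by exact_mod_cast h.t_pos
  refine h.cutSum_eq_winSum h0 h1 fun j _ => ?_
  rw [sub_le_sub_iff_left, mul_le_mul_iff_right₀ ht, Nat.cast_le]

/-- The cutoff w - tκ keeps the terms j ≥ κ of the first progression. The second is kept whole if w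
- tq ≥ 0; otherwise it wraps round above the cutoff and is lost. -/
theorem cutSum_sub_at_term {w : ℤ} (h0 : 0 ≤ w) (h1 : w < (p * q : ℕ)) {κ : ℕ} (hκ : κ ≤ p) :
    cutSum p q s t (w - t * κ) w - cutSum p q s t (w - t * κ) (w - t * q) =
      winSum p q s t w κ p - if t ≤ w / q then winSum p q s t w 0 p else 0 := by
  have ht := h.t_lt
  have ht0 := h.t_pos
  have hq := h.lt_q
  have htq : (t + 1 : ℤ) * q ≤ p * q := mul_le_mul_of_nonneg_right (by omega) (by omega)
  have hlin : (t + 1 : ℤ) * q = t * q + q := by ring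
  have hcast : ((p * q : ℕ) : ℤ) = p * q := by push_cast; ring
  have hκq : (t : ℤ) * κ ≤ t * q := mul_le_mul_of_nonneg_left (by omega) (by omega)
  have hκ0 : (0 : ℤ) ≤ t * κ := by positivity
  have htq0 : (0 : ℤ) ≤ t * q := by positivity
  rw [h.cutSum_at_term h0 h1]
  congr 1
  split_ifs with he
  · have hw := (h.le_ediv_iff _ _).1 he
    rw [← h.winSum_total_sub w, h.cutSum_eq_total (by omega) (by omega) (by omega)]
  · have hw := mt (h.le_ediv_iff _ _).2 he
    rw [cutSum_congr (w' := w - t * q + (p * q : ℕ)) (by rw [sub_add_cancel_left, dvd_neg]),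
      h.cutSum_eq_zero (by omega) (by omega) (by omega)]

theorem sub_cutSum_at_term {w : ℤ} (h0 : 0 ≤ w) (h1 : w < (p * q : ℕ)) {κ : ℕ} (hκ : κ ≤ p) :
    cutSum p q s t (w - t * κ) (w + t * q) - cutSum p q s t (w - t * κ) (w + t * q - t * q) =
      (if p - t ≤ w / q then winSum p q s t w 0 p else 0) - winSum p q s t w κ p := by
  have ht := h.t_lt
  have ht0 := h.t_pos
  have hq := h.lt_q
  have htq : (t + 1 : ℤ) * q ≤ p * q := mul_le_mul_of_nonneg_right (by omega) (by omega)
  have hlin : (t + 1 : ℤ) * q = t * q + q := by ring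
  have hlin' : (p - t : ℤ) * q = p * q - t * q := by ring
  have hcast : ((p * q : ℕ) : ℤ) = p * q := by push_cast; ring
  have hκq := h.mul_lt hκ
  have hκ0 : (0 : ℤ) ≤ t * κ := by positivity
  have htq0 : (q : ℤ) ≤ t * q := le_mul_of_one_le_left (by omega) (by omega)
  rw [add_sub_cancel_right, h.cutSum_at_term h0 h1]
  congr 1
  split_ifs with he
  · have hw := (h.le_ediv_iff _ _).1 he
    have e : winSum p q s t w 0 p = winSum p q s t (w + t * q - (p * q : ℕ)) 0 p := by
      rw [← h.winSum_period (w + t * q - (p * q : ℕ)), sub_add_cancel,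
        ← h.winSum_total_sub (w + t * q), add_sub_cancel_right]
    rw [cutSum_congr (w' := w + t * q - (p * q : ℕ)) (by rw [sub_sub_cancel]), e,
      h.cutSum_eq_total (by omega) (by omega) (by omega)]
  · have hw := mt (h.le_ediv_iff _ _).2 he
    rw [h.cutSum_eq_zero (by omega) (by omega) (by omega)]

end Admissible

/-! ### Extremal window sums -/

/-- The number of terms `t j ≤ w % q`, `j ≥ 0`. -/
def breakIdx (q t : ℕ) (w : ℤ) : ℕ := (w % q / t).toNat + 1

theorem arcInd_compl {p s : ℤ} (hs : 0 < s) (hsp : s < p) (a : ℤ) :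
    arcInd p (p - s) a = 1 - arcInd p s (a + s) := by
  have hp : 0 < p := by omega
  have h0 := Int.emod_nonneg a hp.ne'
  have h1 := Int.emod_lt_of_pos a hp
  have e := Int.mul_ediv_add_emod a p
  by_cases h : a % p < p - s
  · rw [arcInd_congr (a := a + s) (b := a % p + s) ⟨a / p, by linear_combination -e⟩,
      arcInd_of_mem (a := a % p + s) (by omega) (by omega)]
    unfold arcInd
    rw [if_pos h, if_neg (by omega), sub_zero]
  · rw [arcInd_congr (a := a + s) (b := a % p + s - p) ⟨a / p + 1, by linear_combination -e⟩,
      arcInd_of_mem (a := a % p + s - p) (by omega) (by omega)]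
    unfold arcInd
    rw [if_neg h, if_pos (by omega), sub_self]

theorem arcDiff_compl {p s : ℕ} (hs : 0 < s) (hsp : s < p) (a e : ℤ) (J j : ℕ) :
    arcDiff p (p - s : ℤ) a e J j = -arcDiff p s (a + s) e J j := by
  unfold arcDiff
  rw [arcInd_compl (by exact_mod_cast hs) (by exact_mod_cast hsp),
    arcInd_compl (by exact_mod_cast hs) (by exact_mod_cast hsp),
    show a + j - e - 1 + (s : ℤ) = a + s + j - e - 1 by ring,
    show a + j - (if J ≤ j then 1 else 0) + (s : ℤ) = a + s + j - (if J ≤ j then 1 else 0) by ring]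
  ring

/-- As st ≡ 1, each step adds one residue to both arguments; the quotient drops by 1 once tj exceeds
w % q, which is the break. -/
theorem Admissible.binCoeff_eq_arcDiff {p q s t : ℕ} (h : Admissible p q s t) (w : ℤ) {j : ℕ}
    (hj : j < p) : binCoeff p q s (w - t * j) =
      -arcDiff p (p - s : ℤ) (w / q - s * w) (w / q) (breakIdx q t w) j := by
  obtain ⟨c, hc⟩ := h.dvd_st
  have hq : (0 : ℤ) < q := by have := h.lt_q; omega
  have ht : (0 : ℤ) < t := by exact_mod_cast h.t_pos
  have hβ0 := Int.emod_nonneg w hq.ne'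
  have hβ1 := Int.emod_lt_of_pos w hq
  have hw := Int.mul_ediv_add_emod w q
  have htj := h.mul_lt hj.le
  have htj0 : (0 : ℤ) ≤ t * j := by positivity
  have hbr : breakIdx q t w ≤ j ↔ w % q < t * j := by
    unfold breakIdx
    have := Int.ediv_nonneg hβ0 ht.le
    rw [mul_comm, ← Int.ediv_lt_iff_lt_mul ht]
    omega
  have hdiv : (w - t * j) / (q : ℤ) = w / q - if breakIdx q t w ≤ j then 1 else 0 := by
    rw [Int.ediv_eq_iff_of_pos hq]
    simp only [hbr]
    split_ifs with hlt
    · constructor <;> linarith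
    · constructor <;> linarith
  unfold binCoeff arcDiff
  rw [neg_sub, hdiv]
  congr 1
  · exact arcInd_congr ⟨c * j, by linear_combination (j : ℤ) * hc⟩
  · exact arcInd_congr ⟨c * j, by linear_combination (j : ℤ) * hc⟩

/-- The three parameters `k`, `ν`, `ε` for which the coefficients of `Q_{p,q}` are described
by the arc of length `k = min s (p - s)`. -/
structure ArcData (p s k : ℕ) (ν ε : ℤ) : Prop where
  cases : (k = s ∧ ν = s ∧ ε = 1) ∨ (k = p - s ∧ ν = 0 ∧ ε = -1)
  two_mul_lt : 2 * k < p

theorem ArcData.mul_self_eq_one {p s k : ℕ} {ν ε : ℤ} (d : ArcData p s k ν ε) : ε * ε = 1 := by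
  rcases d.cases with ⟨-, -, rfl⟩ | ⟨-, -, rfl⟩ <;> norm_num

theorem cutSum_sub_emod {p q s t : ℕ} (N w : ℤ) :
    cutSum p q s t N w - cutSum p q s t N (w - t * q) =
      cutSum p q s t N (w % (p * q : ℕ)) - cutSum p q s t N (w % (p * q : ℕ) - t * q) := by
  have hd : ((p * q : ℕ) : ℤ) ∣ w - w % (p * q : ℕ) := Int.dvd_self_sub_emod
  rw [cutSum_congr hd, cutSum_congr (w := w - t * q) (w' := w % (p * q : ℕ) - t * q) (by
    rwa [sub_sub_sub_cancel_right])]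

namespace Admissible

variable {p q s t k : ℕ} {ν ε : ℤ} (h : Admissible p q s t) (d : ArcData p s k ν ε)
include h d

theorem arc_pos : 0 < k := by
  have h1 := h.s_pos
  have h2 := h.s_lt
  rcases d.cases with h | h <;> omega

theorem winSum_eq_sum_arcDiff (w : ℤ) {x y : ℕ} (hy : y ≤ p) :
    winSum p q s t w x y = ε *
      ∑ j ∈ Finset.Ico x y, arcDiff p k (w / q - s * w + ν) (w / q) (breakIdx q t w) j := by
  unfold winSum
  rw [Finset.mul_sum]
  refine Finset.sum_congr rfl fun j hj => ?_
  rw [Finset.mem_Ico] at hj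
  have hs := h.s_lt
  rw [h.binCoeff_eq_arcDiff w (by omega)]
  rcases d.cases with ⟨rfl, rfl, rfl⟩ | ⟨rfl, rfl, rfl⟩
  · rw [arcDiff_compl h.s_pos hs, neg_neg, one_mul]
  · rw [Nat.cast_sub hs.le, add_zero, neg_one_mul]

theorem neg_le_mul_winSum (w : ℤ) {x y : ℕ} (hy : y ≤ p) : -k - 1 ≤ ε * winSum p q s t w x y := by
  rw [h.winSum_eq_sum_arcDiff d w hy, ← mul_assoc, d.mul_self_eq_one, one_mul]
  have := d.two_mul_lt
  exact le_sum_arcDiff (by omega) (by omega) _ _ _ (by omega)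

theorem mul_winSum_le (w : ℤ) {x y : ℕ} (hy : y ≤ p) : ε * winSum p q s t w x y ≤ k := by
  rw [h.winSum_eq_sum_arcDiff d w hy, ← mul_assoc, d.mul_self_eq_one, one_mul]
  have := d.two_mul_lt
  exact sum_arcDiff_le (by omega) (by omega) _ _ _ (by omega)

theorem of_mul_winSum_eq {w : ℤ} (h0 : 0 ≤ w) (h1 : w < (p * q : ℕ)) {x y : ℕ} (hy : y ≤ p)
    (hw : ε * winSum p q s t w x y = -k - 1) : k ≤ w / q ∧ w / q ≤ p - 1 - k ∧ t ≠ 1 := by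
  have hq := h.lt_q
  have hk := h.arc_pos d
  have hkp := d.two_mul_lt
  rw [h.winSum_eq_sum_arcDiff d w hy, ← mul_assoc, d.mul_self_eq_one, one_mul] at hw
  obtain ⟨e1, e2, e3⟩ := of_sum_arcDiff_le (by omega) (by omega) hy
    (Int.ediv_nonneg h0 (by omega))
    (Int.ediv_lt_of_lt_mul (by omega) (by push_cast at h1; exact h1)) hw.le
  refine ⟨e1, e2, ?_⟩
  -- For t = 1 also s = k = 1, and the repeated residue is 1, outside the one-element arc {0}.
  rintro rfl
  have hs : s = 1 := by
    have h2 := h.dvd_st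
    have h3 := h.s_lt
    have h4 := h.s_pos
    rw [Nat.cast_one, mul_one, dvd_iff_eq_zero_of_lt (by omega) (by omega)] at h2
    omega
  have hp := h.three_le
  obtain ⟨rfl, rfl, -⟩ : k = s ∧ ν = s ∧ ε = 1 := by
    rcases d.cases with h | h
    · exact h
    · omega
  subst hs
  have hβ := Int.emod_nonneg w (show (q : ℤ) ≠ 0 by omega)
  have hwq := Int.mul_ediv_add_emod w q
  obtain ⟨c, hc⟩ := h.dvd_qt
  have hJ : (breakIdx q 1 w : ℤ) = w % q + 1 := by
    unfold breakIdx
    rw [Nat.cast_one, Int.ediv_one]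
    omega
  rw [hJ, arcInd_congr (b := 1) ⟨-c * (w / q), by
      push_cast at hc ⊢; linear_combination hwq - (w / q) * hc⟩,
    arcInd_of_mem (by omega) (by omega)] at e3
  simp at e3

theorem exists_mul_winSum_eq (ht : t ≠ 1) : ∃ w : ℤ, 0 ≤ w ∧ w < (p * q : ℕ) ∧ w / q = k ∧
    ε * winSum p q s t w k p = -k - 1 := by
  have hq := h.lt_q
  have hk := h.arc_pos d
  have hkp := d.two_mul_lt
  have hp := h.three_le
  have hs0 := h.s_pos
  have hs1 := h.s_lt
  have ht0 := h.t_pos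
  have ht1 := h.t_lt
  obtain ⟨c, hc⟩ := h.dvd_st
  obtain ⟨g, hg⟩ := h.dvd_sq
  have hst : (p : ℤ) ≤ s * t - 1 := by
    refine Int.le_of_dvd ?_ h.dvd_st
    have : 1 * 2 ≤ s * t := Nat.mul_le_mul hs0 (by omega)
    have : (1 * 2 : ℤ) ≤ s * t := by exact_mod_cast this
    omega
  -- The point is w = qk + β. The bounds on β put the break index in [p - k, p - 1], and the
  -- congruence is a ≡ k + 1: it asks β ≡ -t if k = s, and β ≡ (s - 1)t if k = p - s. In the first
  -- case the lower bound follows from st > p, valid as t ≠ 1.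
  obtain ⟨β, hβ0, hβ1, hβ2, hβ3⟩ : ∃ β : ℤ, 0 ≤ β ∧ (p - 1 - k) * t ≤ β ∧ β < (p - 1) * t ∧
      (p : ℤ) ∣ k - s * (q * k + β) + ν - (k + 1) := by
    rcases d.cases with ⟨rfl, rfl, -⟩ | ⟨rfl, rfl, -⟩
    · refine ⟨(p - 1) * t - p, ?_, ?_, ?_, -g * k - c * (p - 1) - 1 + k, ?_⟩
      · have : (2 : ℤ) * (p - 1) ≤ t * (p - 1) :=
          mul_le_mul_of_nonneg_right (by omega) (by omega)
        linarith
      · linarith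
      · omega
      · linear_combination (-(k : ℤ)) * hg - (p - 1 : ℤ) * hc
    · refine ⟨(s - 1) * t, ?_, ?_, ?_, -s * q + g * s - c * (s - 1), ?_⟩
      · exact mul_nonneg (by omega) (by omega)
      · rw [Nat.cast_sub hs1.le]
        exact le_of_eq (by ring)
      · exact mul_lt_mul_of_pos_right (by omega) (by omega)
      · rw [Nat.cast_sub hs1.le]
        linear_combination (s : ℤ) * hg - (s - 1 : ℤ) * hc
  have htp := h.mul_lt (Nat.sub_le p 1)
  rw [Nat.cast_sub (by omega), Nat.cast_one, mul_comm] at htp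
  have hdiv : (q * k + β) / (q : ℤ) = k := by
    rw [Int.ediv_eq_iff_of_pos (by omega)]
    constructor <;> linarith
  have hmod : (q * k + β) % (q : ℤ) = β := by
    rw [Int.mul_add_emod_self_left, Int.emod_eq_of_lt hβ0 (by linarith)]
  have hb1 := (Int.le_ediv_iff_mul_le (c := (t : ℤ)) (by omega)).2 hβ1
  have hb2 := Int.ediv_lt_of_lt_mul (c := (t : ℤ)) (by omega) hβ2
  have hlt : q * k + β < ((p * q : ℕ) : ℤ) := by
    have : ((k : ℤ) + 1) * q ≤ p * q := mul_le_mul_of_nonneg_right (by omega) (by omega)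
    push_cast
    linarith
  refine ⟨q * k + β, by positivity, hlt, hdiv, ?_⟩
  apply le_antisymm _ (h.neg_le_mul_winSum d _ le_rfl)
  rw [h.winSum_eq_sum_arcDiff d _ le_rfl, ← mul_assoc, d.mul_self_eq_one, one_mul, hdiv]
  apply sum_arcDiff_eq_of_break hk hkp hβ3
  · unfold breakIdx
    rw [hmod]
    omega
  · unfold breakIdx
    rw [hmod]
    omega

/-- Taking w % q ≥ tp avoids any break, so the total is 0. The window then yields both k and -k,
whatever the position of w/q relative to t and p - t. -/
theorem exists_mul_winSum_eq_of_total_eq_zero : ∃ w : ℤ, 0 ≤ w ∧ w < (p * q : ℕ) ∧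
    ε * winSum p q s t w (p - k) p = -k ∧ winSum p q s t w 0 p = 0 := by
  have hq := h.lt_q
  have hk := h.arc_pos d
  have hkp := d.two_mul_lt
  have hp := h.three_le
  have hs0 := h.s_pos
  have hs1 := h.s_lt
  have ht0 := h.t_pos
  have ht1 := h.t_lt
  obtain ⟨g, hg⟩ := h.dvd_sq
  have htp := h.mul_lt le_rfl
  obtain ⟨β, hβ1, hβ2, hβ3⟩ : ∃ β : ℤ, t * p ≤ β ∧ β < q ∧
      (p : ℤ) ∣ k - 1 - s * (q * (k - 1) + β) + ν - k := by
    rcases d.cases with ⟨rfl, rfl, -⟩ | ⟨rfl, rfl, -⟩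
    · exact ⟨t * p, le_rfl, by omega, -g * (k - 1) - k * t, by
        linear_combination (1 - k : ℤ) * hg⟩
    · obtain ⟨c, hc⟩ := h.dvd_st
      refine ⟨t * p + 1, by omega, by omega, -s * q + g * (s + 1) - s * t, ?_⟩
      rw [Nat.cast_sub hs1.le]
      linear_combination (s + 1 : ℤ) * hg
  have htp0 : (0 : ℤ) ≤ t * p := by positivity
  have hdiv : (q * (k - 1) + β) / (q : ℤ) = k - 1 := by
    rw [Int.ediv_eq_iff_of_pos (by omega)]
    constructor <;> linarith
  have hmod : (q * (k - 1) + β) % (q : ℤ) = β := by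
    rw [Int.mul_add_emod_self_left, Int.emod_eq_of_lt (by linarith) hβ2]
  have hb1 : (p : ℤ) ≤ β / t := by
    rw [Int.le_ediv_iff_mul_le (by omega), mul_comm]
    exact hβ1
  have hJ : p ≤ breakIdx q t (q * (k - 1) + β) := by
    unfold breakIdx
    rw [hmod]
    omega
  have hlt : q * (k - 1) + β < ((p * q : ℕ) : ℤ) := by
    have : (k : ℤ) * q ≤ p * q := mul_le_mul_of_nonneg_right (by omega) (by omega)
    push_cast
    linarith
  have hnn : (0 : ℤ) ≤ q * (k - 1) := mul_nonneg (by omega) (by omega)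
  refine ⟨q * (k - 1) + β, by linarith, hlt, ?_, ?_⟩
  · rw [h.winSum_eq_sum_arcDiff d _ le_rfl, ← mul_assoc, d.mul_self_eq_one, one_mul, hdiv]
    exact sum_arcDiff_eq_of_no_break hkp hβ3 hJ
  · rw [h.winSum_eq_sum_arcDiff d _ le_rfl, sum_arcDiff_range_eq_zero (by omega) (by omega) _ _ hJ,
      mul_zero]

/-- An extreme value needs k ≤ e ≤ p - 1 - k. With e < t or e ≥ p - t this gives k < t; with e < p -
t or e ≥ t it gives k < p - t. -/
theorem cutSum_sub_bounds (N w : ℤ) :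
    let V := ε * (cutSum p q s t N w - cutSum p q s t N (w - t * q))
    (-k - 1 ≤ V ∧ (V = -k - 1 → k < t ∧ t ≠ 1)) ∧ (V ≤ k + 1 ∧ (V = k + 1 → k < p - t ∧ t ≠ 1)) := by
  intro V
  have hq := h.lt_q
  have hp := h.three_le
  have ht := h.t_lt
  have hM : (0 : ℤ) < (p * q : ℕ) := by
    have : 0 < p * q := Nat.mul_pos (by omega) (by omega)
    exact_mod_cast this
  obtain ⟨w', x, y, h0, h1, hy, hV⟩ := h.cutSum_sub_eq N (Int.emod_nonneg w hM.ne')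
    (Int.emod_lt_of_pos w hM)
  rw [← cutSum_sub_emod] at hV
  have b1 := h.neg_le_mul_winSum d w' (x := x) hy
  have b2 := h.mul_winSum_le d w' (x := x) hy
  have b3 := h.of_mul_winSum_eq d h0 h1 (x := x) hy
  rcases hV with ⟨hV, hw⟩ | ⟨hV, hw⟩
  · have e : V = ε * winSum p q s t w' x y := congrArg (ε * ·) hV
    rw [e]
    refine ⟨⟨b1, fun h' => ?_⟩, by omega, fun h' => by omega⟩
    obtain ⟨c1, c2, c3⟩ := b3 h'
    exact ⟨by omega, c3⟩
  · have e : V = -(ε * winSum p q s t w' x y) := by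
      rw [← mul_neg]
      exact congrArg (ε * ·) hV
    rw [e]
    refine ⟨⟨by omega, fun h' => by omega⟩, by omega, fun h' => ?_⟩
    obtain ⟨c1, c2, c3⟩ := b3 (by omega)
    exact ⟨by omega, c3⟩

theorem exists_cutSum_sub_eq_neg_sub_one (hkt : k < t) (ht : t ≠ 1) : ∃ N w : ℤ,
    ε * (cutSum p q s t N w - cutSum p q s t N (w - t * q)) = -k - 1 := by
  obtain ⟨w, h0, h1, hw, hS⟩ := h.exists_mul_winSum_eq d ht
  have := d.two_mul_lt
  refine ⟨w - t * k, w, ?_⟩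
  rw [h.cutSum_sub_at_term h0 h1 (by omega), hw, if_neg (by omega), sub_zero, hS]

theorem exists_cutSum_sub_eq_add_one (hkt : k < p - t) (ht : t ≠ 1) : ∃ N w : ℤ,
    ε * (cutSum p q s t N w - cutSum p q s t N (w - t * q)) = k + 1 := by
  obtain ⟨w, h0, h1, hw, hS⟩ := h.exists_mul_winSum_eq d ht
  have := d.two_mul_lt
  refine ⟨w - t * k, w + t * q, ?_⟩
  rw [h.sub_cutSum_at_term h0 h1 (by omega), hw, if_neg (by omega), zero_sub, mul_neg, hS]
  ring

theorem exists_cutSum_sub_eq_neg : ∃ N w : ℤ,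
    ε * (cutSum p q s t N w - cutSum p q s t N (w - t * q)) = -k := by
  obtain ⟨w, h0, h1, hS, hT⟩ := h.exists_mul_winSum_eq_of_total_eq_zero d
  refine ⟨w - t * (p - k : ℕ), w, ?_⟩
  rw [h.cutSum_sub_at_term h0 h1 (Nat.sub_le _ _), hT, ite_self, sub_zero, hS]

theorem exists_cutSum_sub_eq : ∃ N w : ℤ,
    ε * (cutSum p q s t N w - cutSum p q s t N (w - t * q)) = k := by
  obtain ⟨w, h0, h1, hS, hT⟩ := h.exists_mul_winSum_eq_of_total_eq_zero d
  refine ⟨w - t * (p - k : ℕ), w + t * q, ?_⟩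
  rw [h.sub_cutSum_at_term h0 h1 (Nat.sub_le _ _), hT, ite_self, zero_sub, mul_neg, hS, neg_neg]

end Admissible

/-! ### Extremes of the coefficient set -/

/-- `S` has smallest element `lo` and largest element `hi`. -/
def HasExtremes (S : Finset ℤ) (lo hi : ℤ) : Prop :=
  lo ∈ S ∧ hi ∈ S ∧ ∀ a ∈ S, lo ≤ a ∧ a ≤ hi

theorem Aminus_Aplus_height_of_hasExtremes {p q r : ℕ} {lo hi m : ℤ}
    (h : HasExtremes (coeffSet p q r) lo hi) (hm : max (-lo) hi = m) :
    Aminus p q r = lo ∧ Aplus p q r = hi ∧ height p q r = m := by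
  obtain ⟨h1, h2, h3⟩ := h
  refine ⟨?_, ?_, ?_⟩
  · exact le_antisymm (Finset.min'_le _ _ h1) (Finset.le_min' _ _ _ fun a ha => (h3 a ha).1)
  · exact le_antisymm (Finset.max'_le _ _ _ fun a ha => (h3 a ha).2) (Finset.le_max' _ _ h2)
  · apply le_antisymm
    · refine Finset.sup'_le _ _ fun a ha => ?_
      obtain ⟨h4, h5⟩ := h3 a ha
      rw [abs_le]
      constructor <;> omega
    · rw [← hm, max_le_iff]
      exact ⟨(neg_le_abs lo).trans (Finset.le_sup' (fun a : ℤ => |a|) h1),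
        (le_abs_self hi).trans (Finset.le_sup' (fun a : ℤ => |a|) h2)⟩

theorem Admissible.hasExtremes {p q s t k : ℕ} {ν ε : ℤ} (h : Admissible p q s t)
    (d : ArcData p s k ν ε) {S : Finset ℤ}
    (hS : ∀ a, a ∈ S ↔ ∃ N w : ℤ, a = cutSum p q s t N w - cutSum p q s t N (w - t * q)) :
    HasExtremes (S.image (ε * ·)) (if k < t ∧ t ≠ 1 then -k - 1 else -k)
      (if k < p - t ∧ t ≠ 1 then k + 1 else k) := by
  have mem : ∀ b : ℤ, (∃ N w : ℤ,
      ε * (cutSum p q s t N w - cutSum p q s t N (w - t * q)) = b) → b ∈ S.image (ε * ·) := by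
    rintro b ⟨N, w, rfl⟩
    exact Finset.mem_image_of_mem _ ((hS _).2 ⟨N, w, rfl⟩)
  refine ⟨?_, ?_, ?_⟩
  · split_ifs with hc
    · exact mem _ (h.exists_cutSum_sub_eq_neg_sub_one d hc.1 hc.2)
    · exact mem _ (h.exists_cutSum_sub_eq_neg d)
  · split_ifs with hc
    · exact mem _ (h.exists_cutSum_sub_eq_add_one d hc.1 hc.2)
    · exact mem _ (h.exists_cutSum_sub_eq d)
  · intro b hb
    obtain ⟨a, ha, rfl⟩ := Finset.mem_image.1 hb
    obtain ⟨N, w, rfl⟩ := (hS a).1 ha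
    obtain ⟨⟨b1, b2⟩, b3, b4⟩ := h.cutSum_sub_bounds d N w
    constructor
    · split_ifs with hc
      · exact b1
      · have := mt b2 hc
        omega
    · split_ifs with hc
      · exact b3
      · have := mt b4 hc
        omega

theorem HasExtremes.image_neg {S : Finset ℤ} {lo hi : ℤ}
    (h : HasExtremes (S.image (-1 * ·)) lo hi) : HasExtremes S (-hi) (-lo) := by
  obtain ⟨h1, h2, h3⟩ := h
  obtain ⟨a, ha, rfl⟩ := Finset.mem_image.1 h1
  obtain ⟨b, hb, rfl⟩ := Finset.mem_image.1 h2
  refine ⟨by simpa using hb, by simpa using ha, fun c hc => ?_⟩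
  obtain ⟨h4, h5⟩ := h3 _ (Finset.mem_image_of_mem _ hc)
  constructor <;> linarith

/-- A solution `r > q` of `r t ≡ ±1` modulo `p q` is at least `p + q`, and prime to `p q`. -/
theorem Admissible.le_of_dvd {p q s t r : ℕ} (h : Admissible p q s t) (hr : q < r) {τ : ℤ}
    (hτ : τ = 1 ∨ τ = -1) (hd : ((p * q : ℕ) : ℤ) ∣ r * t - τ) :
    p + q ≤ r ∧ q.Coprime r ∧ r.Coprime p := by
  have hq := h.lt_q
  have hp := h.three_le
  have ht := h.t_lt
  have ht0 := h.t_pos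
  have hdq : (q : ℤ) ∣ r * t - τ := (Dvd.intro_left (p : ℤ) (by push_cast; rfl)).trans hd
  have hdp : (p : ℤ) ∣ r * t - τ := (Dvd.intro (q : ℤ) (by push_cast; rfl)).trans hd
  have cop : ∀ m : ℕ, (m : ℤ) ∣ r * t - τ → IsCoprime (m : ℤ) (r : ℤ) := by
    rintro m ⟨c, hc⟩
    have hττ : τ * τ = 1 := by rcases hτ with rfl | rfl <;> norm_num
    exact ⟨-τ * c, τ * t, by linear_combination τ * hc + hττ⟩
  refine ⟨?_, Nat.isCoprime_iff_coprime.1 (cop q hdq), (Nat.isCoprime_iff_coprime.1 (cop p hdp)).symm⟩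
  -- If r = q + e with 0 < e < p, then et ≡ τ modulo q with et small, so e = t = τ = 1 and rt - 1 =
  -- q, which pq does not divide.
  by_contra hcon
  obtain ⟨e, rfl⟩ : ∃ e, r = q + e := ⟨r - q, by omega⟩
  have h2 : (q : ℤ) ∣ e * t - τ := by
    rw [show (e : ℤ) * t - τ = ((q + e : ℕ) : ℤ) * t - τ - q * t by push_cast; ring]
    exact dvd_sub hdq (Dvd.intro _ rfl)
  have h3 := h.mul_lt (j := e) (by omega)
  have h4 : (1 : ℤ) ≤ e * t := by
    have : 0 < e * t := Nat.mul_pos (by omega) ht0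
    exact_mod_cast this
  rw [mul_comm] at h3
  rw [dvd_iff_eq_zero_of_lt (by rcases hτ with rfl | rfl <;> omega)
    (by rcases hτ with rfl | rfl <;> omega)] at h2
  have h5 : (e : ℤ) * t = 1 ∧ τ = 1 := by rcases hτ with rfl | rfl <;> omega
  obtain ⟨h5, rfl⟩ := h5
  have h6 : e * t = 1 := by exact_mod_cast h5
  obtain ⟨rfl, rfl⟩ : e = 1 ∧ t = 1 := ⟨Nat.eq_one_of_mul_eq_one_right h6, Nat.eq_one_of_mul_eq_one_left h6⟩
  have h7 : p * q ∣ q := by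
    have : ((p * q : ℕ) : ℤ) ∣ (q : ℤ) := by
      convert hd using 1
      push_cast
      ring
    exact_mod_cast this
  have h8 := Nat.le_of_dvd (by omega) h7
  nlinarith

theorem Admissible.hasExtremes_of_le {p q s t : ℕ} (h : Admissible p q s t) {S : Finset ℤ}
    (hS : ∀ a, a ∈ S ↔ ∃ N w : ℤ, a = cutSum p q s t N w - cutSum p q s t N (w - t * q))
    (hs : 2 * s < p) :
    HasExtremes S (if s < t ∧ t ≠ 1 then -s - 1 else -s)
      (if s < p - t ∧ t ≠ 1 then s + 1 else s) := by
  have := h.hasExtremes (k := s) (ν := s) (ε := 1) ⟨Or.inl ⟨rfl, rfl, rfl⟩, hs⟩ hS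
  simpa only [one_mul, Finset.image_id'] using this

theorem Admissible.hasExtremes_of_ge {p q s t : ℕ} (h : Admissible p q s t) {S : Finset ℤ}
    (hS : ∀ a, a ∈ S ↔ ∃ N w : ℤ, a = cutSum p q s t N w - cutSum p q s t N (w - t * q))
    (hs : 2 * (p - s) < p) :
    HasExtremes S (-(if p - s < p - t ∧ t ≠ 1 then ((p - s : ℕ) : ℤ) + 1 else (p - s : ℕ)))
      (-(if p - s < t ∧ t ≠ 1 then -((p - s : ℕ) : ℤ) - 1 else -(p - s : ℕ))) :=
  (h.hasExtremes (k := p - s) (ν := 0) (ε := -1) ⟨Or.inr ⟨rfl, rfl, rfl⟩, hs⟩ hS).image_neg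

/-- An integer `s` that is invertible modulo `p ≥ 3` is not `p / 2`. -/
theorem Admissible.two_mul_ne {p q s t : ℕ} (h : Admissible p q s t) : 2 * s ≠ p := by
  intro hs
  obtain ⟨c, hc⟩ := h.dvd_st
  have hp := h.three_le
  rw [← hs] at hc
  push_cast at hc
  have : (s : ℤ) ∣ 1 := ⟨t - 2 * c, by linear_combination -hc⟩
  have := Int.le_of_dvd one_pos this
  omega

end InclusionExclusion

theorem theorem3 (p t s q r r' : ℕ) (hp : 3 ≤ p)
    (ht1 : 1 ≤ t) (htp : t ≤ p - 1) (htcop : t.Coprime p)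
    (hs1 : 1 ≤ s) (hsp : s ≤ p - 1) (hst : s * t ≡ 1 [MOD p])
    (hq : p ^ 2 < q) (hr : q < r) (hr' : q < r')
    (hqt : q ≡ t [MOD p])
    (hrt : (r : ℤ) * (t : ℤ) ≡ 1 [ZMOD (p : ℤ) * (q : ℤ)])
    (hrt' : (r' : ℤ) * (t : ℤ) ≡ -1 [ZMOD (p : ℤ) * (q : ℤ)]) :
    -- the coefficient set of the second triple is the negative of that of the first
    InclusionExclusion.coeffSet p q r'
        = (InclusionExclusion.coeffSet p q r).image (fun a => -a) ∧
    -- first case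
    (t = 1 → s = 1 →
      InclusionExclusion.Aminus p q r = -1 ∧
      InclusionExclusion.Aplus p q r = 1 ∧
      InclusionExclusion.height p q r = 1) ∧
    -- second case
    (1 < t → min s (p - s) < min t (p - t) →
      InclusionExclusion.Aminus p q r = -((min s (p - s) : ℕ) : ℤ) - 1 ∧
      InclusionExclusion.Aplus p q r = ((min s (p - s) : ℕ) : ℤ) + 1 ∧
      InclusionExclusion.height p q r = ((min s (p - s) : ℕ) : ℤ) + 1) ∧
    -- third case
    (1 < t → min t (p - t) ≤ min s (p - s) →
      ((min t (p - t), min s (p - s)) = (t, s) ∨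
        (min t (p - t), min s (p - s)) = (p - t, p - s)) →
      InclusionExclusion.Aminus p q r = -((min s (p - s) : ℕ) : ℤ) ∧
      InclusionExclusion.Aplus p q r = ((min s (p - s) : ℕ) : ℤ) + 1 ∧
      InclusionExclusion.height p q r = ((min s (p - s) : ℕ) : ℤ) + 1) ∧
    -- fourth case
    (1 < t → min t (p - t) ≤ min s (p - s) →
      ((min t (p - t), min s (p - s)) = (t, p - s) ∨
        (min t (p - t), min s (p - s)) = (p - t, s)) →
      InclusionExclusion.Aminus p q r = -((min s (p - s) : ℕ) : ℤ) - 1 ∧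
      InclusionExclusion.Aplus p q r = ((min s (p - s) : ℕ) : ℤ) ∧
      InclusionExclusion.height p q r = ((min s (p - s) : ℕ) : ℤ) + 1) := by
  open InclusionExclusion in
  have hst' : (p : ℤ) ∣ s * t - 1 := by
    have := (Nat.modEq_iff_dvd.1 hst.symm)
    push_cast at this
    exact this
  have h : Admissible p q s t := ⟨hp, hs1, by omega, ht1, by omega, hst',
    Nat.modEq_iff_dvd.1 hqt.symm, hq⟩
  have d1 : ((p * q : ℕ) : ℤ) ∣ r * t - 1 := by
    push_cast
    exact Int.modEq_iff_dvd.1 hrt.symm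
  have d2 : ((p * q : ℕ) : ℤ) ∣ r' * t - -1 := by
    push_cast
    exact Int.modEq_iff_dvd.1 hrt'.symm
  have cpq : p.Coprime q := by
    rw [Nat.Coprime, Nat.gcd_comm, hqt.gcd_eq]
    exact htcop
  obtain ⟨l1, c1, c1'⟩ := h.le_of_dvd hr (Or.inl rfl) d1
  obtain ⟨l2, c2, c2'⟩ := h.le_of_dvd hr' (Or.inr rfl) d2
  have hS := mem_coeffSet_iff_of_mul_eq_one hp h.lt_q l1 h.s_pos h.s_lt h.dvd_sq cpq c1 c1' d1
  have hS' := mem_coeffSet_iff_of_mul_eq_neg_one hp h.lt_q l2 h.s_pos h.s_lt h.dvd_sq cpq c2 c2' d2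
  refine ⟨?_, ?_⟩
  · ext a
    rw [hS', Finset.mem_image]
    constructor
    · rintro ⟨N, w, rfl⟩
      exact ⟨_, (hS _).2 ⟨N, w, rfl⟩, rfl⟩
    · rintro ⟨b, hb, rfl⟩
      obtain ⟨N, w, rfl⟩ := (hS b).1 hb
      exact ⟨N, w, rfl⟩
  have hne := h.two_mul_ne
  simp only [Prod.mk.injEq]
  -- This decides k and ε: k = s with ε = 1, or k = p - s with ε = -1. As k < p/2, at least one of k
  -- < t and k < p - t holds, so for t > 1 the height is k + 1.
  rcases Nat.lt_or_ge (2 * s) p with hs | hs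
  · have E := h.hasExtremes_of_le hS hs
    refine ⟨fun _ _ => ?_, fun _ _ => ?_, fun _ _ _ => ?_, fun _ _ _ => ?_⟩ <;>
    · apply Aminus_Aplus_height_of_hasExtremes
      · convert E using 1 <;> split_ifs <;> omega
      · omega
  · have E := h.hasExtremes_of_ge hS (by omega)
    refine ⟨fun _ _ => ?_, fun _ _ => ?_, fun _ _ _ => ?_, fun _ _ _ => ?_⟩ <;>
    · apply Aminus_Aplus_height_of_hasExtremes
      · convert E using 1 <;> split_ifs <;> omega
      · omega
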